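/- Let $n\ge 1$ and $\mathtt k\ge 2$ be integers, let $\sigma\ge 1$ be real, and let $p_1,\dots,p_{\mathtt k}>1$ be real. Consider, for real-valued unknowns $u_1,\dots,u_{\mathtt k}$ and with the convention $u_0:=u_{\mathtt k}$ inside the nonlinearity, the Cauchy problem $$\partial_t^2u_\ell+(-\Delta)^\sigma u_\ell+\partial_tu_\ell+(-\Delta)^\sigma\partial_tu_\ell=|u_{\ell-1}|^{p_\ell},\qquad u_\ell(0,x)=\varepsilon u_{0\ell}(x),\quad \partial_tu_\ell(0,x)=\varepsilon u_{1\ell}(x),\qquad x\in\mathbb R^n,\ \ell=1,\dots,\mathtt k,\tag{1}$$ where $\varepsilon>0$ and $(-\Delta)^\sigma$ is the Fourier multiplier with symbol $|\xi|^{2\sigma}$. Let $P$ be the $\mathtt k\times\mathtt k$ matrix with entries $P_{1\mathtt k}=p_1$, $P_{\ell,\ell-1}=p_\ell$ for $2\le\ell\le\mathtt k$, and zeros elsewhere, and put $(\gamma_1,\dots,\gamma_{\mathtt k})^{\mathtt t}:=(P-I)^{-1}(1,\dots,1)^{\mathtt t}$. A Sobolev solution of (1) on $[0,T)$ is a tuple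 $(u_1,\dots,u_{\mathtt k})\in C([0,T),L^2(\mathbb R^n))^{\mathtt k}$ with $u_\ell(0)=\varepsilon u_{0\ell}$ and $|u_{\ell-1}|^{p_\ell}\in L^1_{\rm loc}([0,T)\times\mathbb R^n)$ which satisfies (1) weakly, i.e. for all $\ell$ and all $\Phi\in C_c^\infty([0,T)\times\mathbb R^n)$ $$\int_0^T\!\!\int|u_{\ell-1}|^{p_\ell}\Phi\,dx\,dt+\varepsilon\!\int u_{1\ell}\Phi(0)\,dx+\varepsilon\!\int u_{0\ell}\big(\Phi(0)+(-\Delta)^\sigma\Phi(0)-\Phi_t(0)\big)dx=\int_0^T\!\!\int u_\ell\big(\Phi_{tt}+(-\Delta)^\sigma\Phi-\Phi_t-(-\Delta)^\sigma\Phi_t\big)dx\,dt .$$ Let $\mathrm{LifeSpan}_\varepsilon\in[0,\infty]$ be the supremum of all $T>0$ for which (1) has a Sobolev solution on $[0,T)$ (with value $0$ if there is none). Assume that for every $\ell=1,\dots,\mathtt k$ one has $(I+(-\Delta)^\sigma)u_{0\ell}\in L^1(\mathbb R^n)$ (in the sense of distributions), $u_{1\ell}\in L^1(\mathbb R^n)$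 and $$\int_{\mathbb R^n}(I+(-\Delta)^\sigma)u_{0\ell}(x)\,dx>0,\qquad \int_{\mathbb R^n}u_{1\ell}(x)\,dx>0,$$ and that $$\gamma_{\mathtt k}>\frac n{2\sigma}.$$ Then there exist constants $\varepsilon_0>0$ and $C>0$ such that for all $\varepsilon\in(0,\varepsilon_0]$ $$\mathrm{LifeSpan}_\varepsilon\le C\,\varepsilon^{-\frac1{\gamma_{\mathtt k}-\frac n{2\sigma}}},$$ where $C$ does not depend on $\varepsilon$. -/

import Mathlib

open MeasureTheory Set Filter Topology
open scoped ContDiff ENNReal FourierTransform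

namespace DoubleDamping

/-- The fractional Laplacian `(-Δ)^σ φ` of a real-valued test function `φ` on `ℝⁿ`: the Fourier
multiplier with symbol `|ξ|^{2σ}`. Mathlib's Fourier transform has the kernel `exp (-2πi⟨y, ξ⟩)`,
so the symbol reads `(2π‖ξ‖)^{2σ}`. The symbol is real and even, so the inverse transform is
real-valued; the real part only changes the codomain. -/
noncomputable def fracLaplacian {n : ℕ} (σ : ℝ) (φ : EuclideanSpace ℝ (Fin n) → ℝ)
    (x : EuclideanSpace ℝ (Fin n)) : ℝ :=
  (𝓕⁻ (fun ξ : EuclideanSpace ℝ (Fin n) =>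
      (((2 * Real.pi * ‖ξ‖) ^ (2 * σ) : ℝ) : ℂ) *
        𝓕 (fun y : EuclideanSpace ℝ (Fin n) => (φ y : ℂ)) ξ) x).re

/-- `(I + (-Δ)^σ) g = f` on `ℝⁿ` in the sense of distributions: the locally integrable function `g`
can be paired with `(-Δ)^σ φ` for every test function `φ ∈ C_c^∞(ℝⁿ)`, and
`∫ g (φ + (-Δ)^σ φ) = ∫ f φ`. -/
structure IsOneAddFracLaplacian {n : ℕ} (σ : ℝ) (g f : EuclideanSpace ℝ (Fin n) → ℝ) : Prop where
  locallyIntegrable_left : LocallyIntegrable g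
  locallyIntegrable_right : LocallyIntegrable f
  integrable_pairing : ∀ φ : EuclideanSpace ℝ (Fin n) → ℝ, ContDiff ℝ ∞ φ → HasCompactSupport φ →
    Integrable (fun x => g x * fracLaplacian σ φ x)
  pairing_eq : ∀ φ : EuclideanSpace ℝ (Fin n) → ℝ, ContDiff ℝ ∞ φ → HasCompactSupport φ →
    ∫ x, g x * (φ x + fracLaplacian σ φ x) = ∫ x, f x * φ x

/-- The `k × k` matrix `P` with `P_{1,k} = p_1`, `P_{ℓ,ℓ-1} = p_ℓ` for `2 ≤ ℓ ≤ k`, and zeros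
elsewhere. (Indices are shifted to `0, …, k-1`; `finRotate k` is the cyclic successor.) -/
def expMatrix {k : ℕ} (p : Fin k → ℝ) : Matrix (Fin k) (Fin k) ℝ :=
  Matrix.of fun i j => if i = finRotate k j then p i else 0

/-- The vector `γ = (P - I)⁻¹ (1, …, 1)ᵗ`. -/
noncomputable def gammaVec {k : ℕ} (p : Fin k → ℝ) : Fin k → ℝ :=
  Matrix.mulVec (expMatrix p - 1)⁻¹ (fun _ => 1)

/-- A test function `Φ ∈ C_c^∞([0,T) × ℝⁿ)`, given as a smooth compactly supported function on
`ℝ × ℝⁿ` whose support lies in `{t < T}` (it need not vanish at `t = 0`). -/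
structure IsTestFunction {n : ℕ} (T : ℝ) (Φ : ℝ → EuclideanSpace ℝ (Fin n) → ℝ) : Prop where
  contDiff : ContDiff ℝ ∞ (fun z : ℝ × EuclideanSpace ℝ (Fin n) => Φ z.1 z.2)
  hasCompactSupport : HasCompactSupport (fun z : ℝ × EuclideanSpace ℝ (Fin n) => Φ z.1 z.2)
  tsupport_subset : tsupport (fun z : ℝ × EuclideanSpace ℝ (Fin n) => Φ z.1 z.2) ⊆ Iio T ×ˢ univ

/-- The time derivative `∂ₜ Φ`. -/
noncomputable def timeDeriv {n : ℕ} (Φ : ℝ → EuclideanSpace ℝ (Fin n) → ℝ) :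
    ℝ → EuclideanSpace ℝ (Fin n) → ℝ :=
  fun t x => deriv (fun s => Φ s x) t

/-- `v ∈ C([0,T), L²(ℝⁿ))`, for a measurable function `v = v(t,x)`. -/
structure IsContinuousL2 {n : ℕ} (T : ℝ) (v : ℝ → EuclideanSpace ℝ (Fin n) → ℝ) : Prop where
  aestronglyMeasurable :
    AEStronglyMeasurable (fun z : ℝ × EuclideanSpace ℝ (Fin n) => v z.1 z.2)
      (volume.restrict (Ico 0 T ×ˢ univ))
  memLp : ∀ t ∈ Ico 0 T, MemLp (v t) 2
  continuous : ∀ t ∈ Ico 0 T,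
    Tendsto (fun s => eLpNorm (v s - v t) 2 volume) (𝓝[Ico 0 T] t) (𝓝 0)

/-- `v` is a weak solution on `[0,T) × ℝⁿ` of the linear Cauchy problem with source `F`
`∂ₜ² v + (-Δ)^σ v + ∂ₜ v + (-Δ)^σ ∂ₜ v = F`, `v(0,·) = v₀`, `∂ₜ v(0,·) = v₁`:
the equation is multiplied by a test function `Φ ∈ C_c^∞([0,T) × ℝⁿ)` and all derivatives
are moved onto `Φ`. -/
def IsWeakSolution {n : ℕ} (σ T : ℝ) (F v : ℝ → EuclideanSpace ℝ (Fin n) → ℝ)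
    (v₀ v₁ : EuclideanSpace ℝ (Fin n) → ℝ) : Prop :=
  ∀ Φ : ℝ → EuclideanSpace ℝ (Fin n) → ℝ, IsTestFunction T Φ →
    (∫ t in Ico 0 T, ∫ x, F t x * Φ t x)
      + (∫ x, v₁ x * Φ 0 x)
      + (∫ x, v₀ x * (Φ 0 x + fracLaplacian σ (Φ 0) x - timeDeriv Φ 0 x))
    = ∫ t in Ico 0 T, ∫ x, v t x *
        (timeDeriv (timeDeriv Φ) t x + fracLaplacian σ (Φ t) x
          - timeDeriv Φ t x - fracLaplacian σ (timeDeriv Φ t) x)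

/-- `(u_1, …, u_k) ∈ C([0,T), L²)^k` is a Sobolev solution on `[0,T)` of the cyclic system
`∂ₜ² u_ℓ + (-Δ)^σ u_ℓ + ∂ₜ u_ℓ + (-Δ)^σ ∂ₜ u_ℓ = |u_{ℓ-1}|^{p_ℓ}` (with `u_0 := u_k`)
and data `u_ℓ(0) = u_{0ℓ}`, `∂ₜ u_ℓ(0) = u_{1ℓ}`. The nonlinearities are locally integrable on
`[0,T) × ℝⁿ`, so that the equations make sense as distributions. -/
structure IsSobolevSolution {n k : ℕ} (σ : ℝ) (p : Fin k → ℝ) (T : ℝ)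
    (u₀ u₁ : Fin k → EuclideanSpace ℝ (Fin n) → ℝ)
    (u : Fin k → ℝ → EuclideanSpace ℝ (Fin n) → ℝ) : Prop where
  continuousL2 : ∀ l, IsContinuousL2 T (u l)
  initial : ∀ l, u l 0 =ᵐ[volume] u₀ l
  locallyIntegrableOn : ∀ l, LocallyIntegrableOn
    (fun z : ℝ × EuclideanSpace ℝ (Fin n) => |u ((finRotate k).symm l) z.1 z.2| ^ p l)
    (Ico 0 T ×ˢ univ)
  weak : ∀ l, IsWeakSolution σ T (fun t x => |u ((finRotate k).symm l) t x| ^ p l)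
    (u l) (u₀ l) (u₁ l)

/-- The lifespan for the data `(u_{0ℓ}, u_{1ℓ})`: the supremum in `[0,∞]` of all `T > 0` such that
a Sobolev solution on `[0,T)` exists. -/
noncomputable def lifeSpan {n k : ℕ} (σ : ℝ) (p : Fin k → ℝ)
    (u₀ u₁ : Fin k → EuclideanSpace ℝ (Fin n) → ℝ) : ℝ≥0∞ :=
  sSup {τ : ℝ≥0∞ | ∃ T : ℝ, 0 < T ∧ τ = ENNReal.ofReal T ∧
    ∃ u : Fin k → ℝ → EuclideanSpace ℝ (Fin n) → ℝ, IsSobolevSolution σ p T u₀ u₁ u}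

end DoubleDamping

/-!
The proof is the test function method. The equation for `u_ℓ` is tested with `ψ(t / T) φ(x / R)`,
where `R ^ {2σ} = T ≥ 1`; every term of the adjoint operator then gains at least a factor `T⁻¹`.
With `S_ℓ = ∬ |u_ℓ| ψ^{1/q} φ`, where `q = p_{ℓ+1}` is the power of `|u_ℓ|` in the next equation, the
weak formulation bounds both `ε` (the data) and `∬ |u_{ℓ-1}|^{p_ℓ} ψ φ` by a multiple of `T⁻¹ S_ℓ`,
and Hölder's inequality bounds `S_{ℓ-1}^{p_ℓ}` by the latter integral. The weighted quantities
`T^{γ_ℓ - 1 - n/(2σ)} S_ℓ` satisfy a cyclic system `w_{ℓ-1}^{p_ℓ} ≤ C w_ℓ` free of `T`, because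
`p_ℓ γ_{ℓ-1} = 1 + γ_ℓ`. Such a system bounds all `w_ℓ`, while `w_k ≥ c ε T^{γ_k - n/(2σ)}`
(`cyclic_estimate`, `exists_le_rpow_of_cyclic`).

The fractional Laplacian is not local, and the weak formulation admits only compactly supported test
functions. The remedy is a positive integrable weight `φ` that is the pointwise limit of functions
`φm ≤ φ` in `C_c^∞` with `|(-Δ)^σ φm| ≤ K φ`, uniformly in `m` (`exists_isTestProfile`): `φ` is the
convolution of `(1 + ‖x‖)^{-(n+1)}` with a bump function `g`, and `φm` the convolution of its
restriction to a ball with `g`. The bound follows from the decay of `(-Δ)^σ g` like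
`(1 + ‖x‖)^{-(n+1)}` (`exists_fourierInv_rpow_mul_le`). For high frequencies the symbol `‖ξ‖^{2σ}` is
smooth of temperate growth. For low frequencies, the kernel `L` with symbol `m(ξ) ‖ξ‖^{2σ}` satisfies
`L(x) = 2^{-2σ-n} L(x/2) + Λ(x)` with a Schwartz function `Λ`, and iterating this relation gives the
decay (`le_polyWeight_of_dilation`). Fatou's lemma then lets `m → ∞` in the weak formulation.
-/

namespace DoubleDamping

/-! ### The weight `(1 + ‖x‖)^{-(n+1)}` -/

/-- The weight `(1 + ‖x‖)^{-(n+1)}` on `ℝⁿ`: integrable, slowly varying, and essentially stable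
under convolution with itself. -/
noncomputable def polyWeight {n : ℕ} (x : EuclideanSpace ℝ (Fin n)) : ℝ :=
  ((1 + ‖x‖) ^ (n + 1))⁻¹

section Weight

variable {n : ℕ}

lemma polyWeight_pos (x : EuclideanSpace ℝ (Fin n)) : 0 < polyWeight x := by
  unfold polyWeight; positivity

lemma continuous_polyWeight : Continuous (polyWeight (n := n)) := by
  unfold polyWeight
  refine Continuous.inv₀ (by fun_prop) fun x => ?_
  positivity

lemma integrable_polyWeight : Integrable (polyWeight (n := n)) := by
  have h := integrable_one_add_norm (E := EuclideanSpace ℝ (Fin n)) (μ := volume)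
    (r := ((n + 1 : ℕ) : ℝ)) (by simp)
  refine h.congr (Eventually.of_forall fun x => ?_)
  simp only [polyWeight]
  rw [Real.rpow_neg (by positivity), Real.rpow_natCast]

/-- The weight varies by at most a constant factor when the norm is multiplied by at most `c`. -/
lemma polyWeight_le_of_norm_le {x y : EuclideanSpace ℝ (Fin n)} {c : ℝ}
    (h : 1 + ‖x‖ ≤ c * (1 + ‖y‖)) : polyWeight y ≤ c ^ (n + 1) * polyWeight x := by
  unfold polyWeight
  have hx : (0 : ℝ) < 1 + ‖x‖ := by positivity
  have hy : (0 : ℝ) < 1 + ‖y‖ := by positivity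
  rw [← div_eq_mul_inv, le_div_iff₀ (by positivity), ← div_eq_inv_mul, div_le_iff₀ (by positivity),
    ← mul_pow]
  gcongr

lemma polyWeight_mul_le (x y : EuclideanSpace ℝ (Fin n)) :
    polyWeight y * polyWeight (x - y) ≤
      2 ^ (n + 1) * polyWeight x * (polyWeight y + polyWeight (x - y)) := by
  have h : ‖x‖ ≤ ‖y‖ + ‖x - y‖ := by simpa using norm_add_le y (x - y)
  have hy := polyWeight_pos y
  have hxy := polyWeight_pos (x - y)
  rcases le_total ‖y‖ ‖x - y‖ with h' | h'
  · have := polyWeight_le_of_norm_le (x := x) (y := x - y) (c := 2) (by linarith [norm_nonneg y])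
    nlinarith [mul_pos hy hxy, mul_pos hxy (polyWeight_pos x),
      mul_nonneg (mul_nonneg (pow_nonneg (zero_le_two (α := ℝ)) (n + 1)) (polyWeight_pos x).le)
        hxy.le]
  · have := polyWeight_le_of_norm_le (x := x) (y := y) (c := 2) (by linarith [norm_nonneg (x - y)])
    nlinarith [mul_pos hy hxy, mul_pos hxy (polyWeight_pos x),
      mul_nonneg (mul_nonneg (pow_nonneg (zero_le_two (α := ℝ)) (n + 1)) (polyWeight_pos x).le)
        hy.le]

lemma integrable_polyWeight_sub (x : EuclideanSpace ℝ (Fin n)) :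
    Integrable fun y => polyWeight (x - y) :=
  integrable_polyWeight.comp_sub_left x

lemma integrable_polyWeight_mul (x : EuclideanSpace ℝ (Fin n)) :
    Integrable fun y => polyWeight y * polyWeight (x - y) := by
  refine ((integrable_polyWeight.add (integrable_polyWeight_sub x)).const_mul
    (2 ^ (n + 1) * polyWeight x)).mono' ?_ (Eventually.of_forall fun y => ?_)
  · exact (continuous_polyWeight.mul
      (continuous_polyWeight.comp (by fun_prop))).aestronglyMeasurable
  · rw [Real.norm_of_nonneg (mul_pos (polyWeight_pos _) (polyWeight_pos _)).le]
    exact polyWeight_mul_le x y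

lemma integral_polyWeight_mul_le (x : EuclideanSpace ℝ (Fin n)) :
    ∫ y, polyWeight y * polyWeight (x - y) ≤
      2 ^ (n + 2) * (∫ y : EuclideanSpace ℝ (Fin n), polyWeight y) * polyWeight x := by
  calc ∫ y, polyWeight y * polyWeight (x - y)
      ≤ ∫ y, 2 ^ (n + 1) * polyWeight x * (polyWeight y + polyWeight (x - y)) :=
        integral_mono (integrable_polyWeight_mul x)
          ((integrable_polyWeight.add (integrable_polyWeight_sub x)).const_mul _)
          (polyWeight_mul_le x)
    _ = _ := by
        rw [integral_const_mul, integral_add integrable_polyWeight (integrable_polyWeight_sub x),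
          integral_sub_left_eq_self (fun y => polyWeight y) volume x]
        ring

/-- A convolution of two functions dominated by the weight is dominated by the weight. -/
lemma norm_integral_mul_le_polyWeight {f g : EuclideanSpace ℝ (Fin n) → ℂ} {A B : ℝ}
    (hf : ∀ x, ‖f x‖ ≤ A * polyWeight x) (hg : ∀ x, ‖g x‖ ≤ B * polyWeight x)
    (x : EuclideanSpace ℝ (Fin n)) :
    ‖∫ y, f y * g (x - y)‖ ≤
      A * B * (2 ^ (n + 2) * ∫ y : EuclideanSpace ℝ (Fin n), polyWeight y) * polyWeight x := by
  have hA : 0 ≤ A := nonneg_of_mul_nonneg_left ((norm_nonneg _).trans (hf x)) (polyWeight_pos x)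
  have hB : 0 ≤ B := nonneg_of_mul_nonneg_left ((norm_nonneg _).trans (hg x)) (polyWeight_pos x)
  calc ‖∫ y, f y * g (x - y)‖
      ≤ ∫ y, A * B * (polyWeight y * polyWeight (x - y)) := by
        refine norm_integral_le_of_norm_le ((integrable_polyWeight_mul x).const_mul _)
          (Eventually.of_forall fun y => ?_)
        rw [norm_mul]
        calc _ ≤ (A * polyWeight y) * (B * polyWeight (x - y)) :=
              mul_le_mul (hf _) (hg _) (norm_nonneg _) (mul_nonneg hA (polyWeight_pos _).le)
          _ = _ := by ring
    _ ≤ _ := by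
        rw [integral_const_mul]
        calc _ ≤ A * B * (2 ^ (n + 2) * (∫ y : EuclideanSpace ℝ (Fin n), polyWeight y)
              * polyWeight x) :=
              mul_le_mul_of_nonneg_left (integral_polyWeight_mul_le x) (mul_nonneg hA hB)
          _ = _ := by ring

/-- A bounded function satisfying a contractive dilation inequality up to an error of the size of
the weight is itself of the size of the weight. The contraction factor `a ≤ 2^{-(n+2)}` beats the loss
of at most `2^{n+1}` of the weight between `x / 2` and `x`. -/
lemma le_polyWeight_of_dilation {L : EuclideanSpace ℝ (Fin n) → ℂ} {a B C : ℝ} (ha : 0 ≤ a)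
    (ha' : a * 2 ^ (n + 1) ≤ 1 / 2) (hB : ∀ x, ‖L x‖ ≤ B)
    (hL : ∀ x, ‖L x‖ ≤ a * ‖L ((2 : ℝ)⁻¹ • x)‖ + C * polyWeight x) :
    ∃ A, ∀ x, ‖L x‖ ≤ A * polyWeight x := by
  have hB0 : 0 ≤ B := (norm_nonneg _).trans (hB 0)
  set A := max (B * 2 ^ (n + 1)) (2 * C) with hA
  have hA0 : 0 ≤ A := le_max_of_le_left (by positivity)
  have key : ∀ j : ℕ, ∀ x : EuclideanSpace ℝ (Fin n), ‖x‖ ≤ 2 ^ j → ‖L x‖ ≤ A * polyWeight x := by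
    intro j
    induction j with
    | zero =>
      intro x hx
      have h1 : (2 ^ (n + 1))⁻¹ ≤ polyWeight x := by
        unfold polyWeight
        gcongr
        simp at hx
        linarith
      calc ‖L x‖ ≤ B := hB x
        _ = B * 2 ^ (n + 1) * (2 ^ (n + 1))⁻¹ := by field_simp
        _ ≤ A * polyWeight x := by
            gcongr
            exact le_max_left _ _
    | succ j ih =>
      intro x hx
      have h1 : ‖(2 : ℝ)⁻¹ • x‖ = ‖x‖ / 2 := by
        rw [norm_smul]; norm_num; ring
      have h2 := ih ((2 : ℝ)⁻¹ • x) (by rw [h1]; rw [pow_succ] at hx; linarith)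
      have h3 := polyWeight_le_of_norm_le (x := x) (y := (2 : ℝ)⁻¹ • x) (c := 2)
        (by rw [h1]; linarith)
      have hx0 := polyWeight_pos x
      calc ‖L x‖ ≤ a * ‖L ((2 : ℝ)⁻¹ • x)‖ + C * polyWeight x := hL x
        _ ≤ a * (A * (2 ^ (n + 1) * polyWeight x)) + C * polyWeight x := by
            gcongr
            exact h2.trans (by gcongr)
        _ = (a * 2 ^ (n + 1)) * (A * polyWeight x) + C * polyWeight x := by ring
        _ ≤ 1 / 2 * (A * polyWeight x) + A / 2 * polyWeight x := by
            gcongr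
            linarith [le_max_right (B * 2 ^ (n + 1)) (2 * C)]
        _ = A * polyWeight x := by ring
  refine ⟨A, fun x => ?_⟩
  obtain ⟨j, hj⟩ := pow_unbounded_of_one_lt ‖x‖ (one_lt_two (α := ℝ))
  exact key j x hj.le

/-- Schwartz functions decay faster than the weight. -/
lemma exists_schwartz_le_polyWeight (f : SchwartzMap (EuclideanSpace ℝ (Fin n)) ℂ) :
    ∃ C, ∀ x, ‖f x‖ ≤ C * polyWeight x := by
  refine ⟨2 ^ (n + 1) * ((Finset.Iic (n + 1, 0)).sup fun m => SchwartzMap.seminorm ℝ m.1 m.2) f,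
    fun x => ?_⟩
  have := SchwartzMap.one_add_le_sup_seminorm_apply (𝕜 := ℝ) (m := (n + 1, 0)) le_rfl le_rfl f x
  rw [norm_iteratedFDeriv_zero, ← le_div_iff₀' (by positivity), div_eq_mul_inv] at this
  exact this

end Weight

/-! ### Fourier transforms: dilations and products -/

section Fourier

variable {n : ℕ}

lemma fourier_comp_smul (f : EuclideanSpace ℝ (Fin n) → ℂ) {c : ℝ} (hc : 0 < c)
    (ξ : EuclideanSpace ℝ (Fin n)) :
    𝓕 (fun y => f (c • y)) ξ = ((c ^ n)⁻¹ : ℝ) • 𝓕 f (c⁻¹ • ξ) := by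
  rw [Real.fourier_eq, Real.fourier_eq]
  have := Measure.integral_comp_smul volume
    (fun v : EuclideanSpace ℝ (Fin n) => Real.fourierChar (-(inner ℝ v (c⁻¹ • ξ))) • f v) c
  rw [finrank_euclideanSpace_fin, abs_of_pos (by positivity)] at this
  rw [← this]
  congr 1 with v
  simp only [inner_smul_left, inner_smul_right]
  congr 3
  simp
  field_simp

lemma fourierInv_comp_smul (f : EuclideanSpace ℝ (Fin n) → ℂ) {c : ℝ} (hc : 0 < c)
    (ξ : EuclideanSpace ℝ (Fin n)) :
    𝓕⁻ (fun y => f (c • y)) ξ = ((c ^ n)⁻¹ : ℝ) • 𝓕⁻ f (c⁻¹ • ξ) := by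
  rw [Real.fourierInv_eq_fourier_neg, Real.fourierInv_eq_fourier_neg, fourier_comp_smul f hc,
    smul_neg]

/-- The inverse transform of `a · 𝓕 f` is the convolution of `f` with the inverse transform
of `a`. -/
lemma fourierInv_mul_fourier {a f : EuclideanSpace ℝ (Fin n) → ℂ} (ha : Integrable a)
    (hf : Integrable f) (x : EuclideanSpace ℝ (Fin n)) :
    𝓕⁻ (fun ξ => a ξ * 𝓕 f ξ) x = ∫ y, f y * 𝓕⁻ a (x - y) := by
  have hb : Integrable fun ξ => Real.fourierChar (inner ℝ ξ x) • a ξ := by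
    have := (Real.fourierIntegral_convergent_iff (μ := volume) (f := a) (-x)).2 ha
    simpa using this
  have key := VectorFourier.integral_fourierIntegral_smul_eq_flip (e := Real.fourierChar)
    (μ := volume) (ν := volume) (L := innerₗ (EuclideanSpace ℝ (Fin n)))
    (f := f) (g := fun ξ => Real.fourierChar (inner ℝ ξ x) • a ξ) Real.continuous_fourierChar
    (by simpa using continuous_inner) hf hb
  rw [Real.fourierInv_eq]
  calc _ = ∫ ξ, VectorFourier.fourierIntegral Real.fourierChar volume
        (innerₗ (EuclideanSpace ℝ (Fin n))) f ξ • (Real.fourierChar (inner ℝ ξ x) • a ξ) := by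
        congr 1 with ξ
        change _ = 𝓕 f ξ • _
        simp only [Circle.smul_def, smul_eq_mul]
        ring
    _ = _ := key
    _ = _ := by
        congr 1 with y
        rw [smul_eq_mul, Real.fourierInv_eq]
        congr 1
        change ∫ ξ, _ = _
        congr 1 with ξ
        rw [inner_sub_right, sub_eq_add_neg, AddChar.map_add_eq_mul, mul_comm, mul_smul]
        simp [real_inner_comm]

end Fourier

/-! ### Decay of fractional Laplacians of Schwartz functions -/

section Decay

variable {n : ℕ}

/-- The real power `s ↦ s ^ σ`, composed with a function of temperate growth that is bounded below
by `1`, has temperate growth. -/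
lemma hasTemperateGrowth_rpow {q : EuclideanSpace ℝ (Fin n) → ℝ} (hq : q.HasTemperateGrowth)
    (hq1 : ∀ x, 1 ≤ q x) {σ : ℝ} (hσ : 0 ≤ σ) :
    Function.HasTemperateGrowth fun x => q x ^ σ := by
  set t := {y : ℝ | 1 / 2 < y} with ht_def
  have hpos : ∀ x ∈ t, 0 < x := fun x hx => lt_trans (by norm_num) hx
  have hunique : UniqueDiffOn ℝ t := (isOpen_lt' (1 / 2 : ℝ)).uniqueDiffOn
  have hdiff : ContDiffOn ℝ ∞ (fun x : ℝ => x ^ σ) t :=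
    contDiffOn_fun_id.rpow_const_of_ne fun x hx => (hpos x hx).ne'
  refine Function.HasTemperateGrowth.comp' (g := fun x : ℝ => x ^ σ) (f := q) (t := t) ?_
    hunique hdiff ?_ hq
  · rintro - ⟨y, rfl⟩
    exact lt_of_lt_of_le (by norm_num) (hq1 y)
  intro N
  obtain ⟨k, hk⟩ := exists_nat_ge σ
  refine ⟨k, (∑ i ∈ Finset.range (N + 1), ‖Polynomial.eval σ (descPochhammer ℝ i)‖) * 2 ^ N,
    by positivity, fun m hm x hx => ?_⟩
  have hx0 := hpos x hx
  have hsm : ContDiffAt ℝ m (fun x : ℝ => x ^ σ) x := Real.contDiffAt_rpow_const <| Or.inl hx0.ne'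
  rw [norm_iteratedFDerivWithin_eq_norm_iteratedDerivWithin,
    iteratedDerivWithin_eq_iteratedDeriv hunique hsm hx, iteratedDeriv_eq_iterate,
    Real.iter_deriv_rpow_const, norm_mul, mul_assoc]
  gcongr ?_ * ?_
  · exact Finset.single_le_sum (f := fun i => ‖Polynomial.eval σ (descPochhammer ℝ i)‖)
      (fun _ _ => by positivity) (by grind)
  · rw [Real.norm_of_nonneg (by positivity), Real.rpow_sub hx0, Real.rpow_natCast, div_eq_inv_mul]
    gcongr ?_ * ?_
    · calc (x ^ m)⁻¹ = x⁻¹ ^ m := by rw [inv_pow]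
        _ ≤ 2 ^ m := by
          gcongr
          rw [inv_le_comm₀ hx0 (by norm_num)]
          have : (1 : ℝ) / 2 < x := hx
          linarith
        _ ≤ 2 ^ N := by gcongr; norm_num
    · calc x ^ σ ≤ (1 + ‖x‖) ^ σ := by
            gcongr
            rw [Real.norm_of_nonneg hx0.le]; linarith
        _ ≤ (1 + ‖x‖) ^ (k : ℝ) := Real.rpow_le_rpow_of_exponent_le (by simp) hk
        _ = _ := by rw [Real.rpow_natCast]

/-- A smooth cutoff, equal to `1` for `‖ξ‖ ≤ 2` and to `0` for `3 ≤ ‖ξ‖`. -/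
noncomputable def freqCutoff (n : ℕ) : ContDiffBump (0 : EuclideanSpace ℝ (Fin n)) where
  rIn := 2
  rOut := 3
  rIn_pos := by norm_num
  rIn_lt_rOut := by norm_num

lemma freqCutoff_eq_one {x : EuclideanSpace ℝ (Fin n)} (h : ‖x‖ ≤ 2) : freqCutoff n x = 1 :=
  (freqCutoff n).one_of_mem_closedBall (by simpa [freqCutoff] using h)

lemma freqCutoff_eq_zero {x : EuclideanSpace ℝ (Fin n)} (h : 3 ≤ ‖x‖) : freqCutoff n x = 0 :=
  (freqCutoff n).zero_of_le_dist (by simpa [freqCutoff] using h)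

/-- The high-frequency part of the symbol has temperate growth: it is `q ^ σ` times a cutoff, for a
smooth function `q ≥ 1` that agrees with `‖ξ‖²` where the cutoff does not vanish. -/
lemma hasTemperateGrowth_highFreq {σ : ℝ} (hσ : 0 ≤ σ) :
    Function.HasTemperateGrowth fun ξ : EuclideanSpace ℝ (Fin n) =>
      (((1 - freqCutoff n ξ) * ‖ξ‖ ^ (2 * σ) : ℝ) : ℂ) := by
  let m : ContDiffBump (0 : EuclideanSpace ℝ (Fin n)) :=
    { rIn := 1, rOut := 2, rIn_pos := by norm_num, rIn_lt_rOut := by norm_num }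
  have hm : Function.HasTemperateGrowth (m : EuclideanSpace ℝ (Fin n) → ℝ) :=
    m.hasCompactSupport.hasTemperateGrowth m.contDiff
  have hc : Function.HasTemperateGrowth (freqCutoff n : EuclideanSpace ℝ (Fin n) → ℝ) :=
    (freqCutoff n).hasCompactSupport.hasTemperateGrowth (freqCutoff n).contDiff
  have hq : Function.HasTemperateGrowth fun ξ : EuclideanSpace ℝ (Fin n) => ‖ξ‖ ^ 2 + m ξ :=
    (Function.hasTemperateGrowth_norm_sq _).add hm
  have hqσ := hasTemperateGrowth_rpow hq (fun x => by
    rcases le_total ‖x‖ 1 with h | h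
    · rw [m.one_of_mem_closedBall (by simpa [m] using h)]
      nlinarith [norm_nonneg x]
    · nlinarith [m.nonneg (x := x)]) hσ
  have h1 := ((Function.HasTemperateGrowth.const (1 : ℝ)).sub hc).mul hqσ
  have h2 := Function.Complex.hasTemperateGrowth_ofReal.comp h1
  refine (congrArg Function.HasTemperateGrowth ?_).mp h2
  funext ξ
  simp only [Function.comp_apply, Pi.mul_apply, Pi.sub_apply]
  congr 1
  rcases le_total ‖ξ‖ 2 with h | h
  · rw [freqCutoff_eq_one h]; simp
  · rw [m.zero_of_le_dist (by simpa [m] using h), add_zero, ← Real.rpow_natCast,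
      ← Real.rpow_mul (norm_nonneg _)]
    norm_num

lemma continuous_lowFreq {σ : ℝ} (hσ : 0 ≤ σ) :
    Continuous fun ξ : EuclideanSpace ℝ (Fin n) =>
      ((freqCutoff n ξ * ‖ξ‖ ^ (2 * σ) : ℝ) : ℂ) := by
  have h1 := (freqCutoff n).continuous
  have h2 : Continuous fun ξ : EuclideanSpace ℝ (Fin n) => ‖ξ‖ ^ (2 * σ) :=
    continuous_norm.rpow_const fun _ => Or.inr (by positivity)
  fun_prop

lemma integrable_lowFreq {σ : ℝ} (hσ : 0 ≤ σ) :
    Integrable fun ξ : EuclideanSpace ℝ (Fin n) =>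
      ((freqCutoff n ξ * ‖ξ‖ ^ (2 * σ) : ℝ) : ℂ) := by
  refine (continuous_lowFreq hσ).integrable_of_hasCompactSupport ?_
  refine HasCompactSupport.intro (isCompact_closedBall 0 3) fun x hx => ?_
  rw [freqCutoff_eq_zero (by simpa using (not_le.1 (by simpa using hx)).le)]
  simp

/-- The difference of two dyadic pieces of the low-frequency symbol is supported in an annulus,
where the symbol is smooth. -/
lemma exists_schwartz_annulus (σ : ℝ) :
    ∃ θ : SchwartzMap (EuclideanSpace ℝ (Fin n)) ℂ, ∀ ξ,
      θ ξ = (((freqCutoff n ξ - freqCutoff n ((2 : ℝ) • ξ)) * ‖ξ‖ ^ (2 * σ) : ℝ) : ℂ) := by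
  have hcs : HasCompactSupport fun ξ : EuclideanSpace ℝ (Fin n) =>
      (((freqCutoff n ξ - freqCutoff n ((2 : ℝ) • ξ)) * ‖ξ‖ ^ (2 * σ) : ℝ) : ℂ) := by
    refine HasCompactSupport.intro (isCompact_closedBall 0 3) fun x hx => ?_
    have hx' : 3 ≤ ‖x‖ := by simpa using (not_le.1 (by simpa using hx)).le
    rw [freqCutoff_eq_zero hx', freqCutoff_eq_zero (by rw [norm_smul]; norm_num; linarith)]
    simp
  have hsm : ContDiff ℝ ∞ fun ξ : EuclideanSpace ℝ (Fin n) =>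
      (((freqCutoff n ξ - freqCutoff n ((2 : ℝ) • ξ)) * ‖ξ‖ ^ (2 * σ) : ℝ) : ℂ) := by
    refine Complex.ofRealCLM.contDiff.comp (contDiff_iff_contDiffAt.2 fun ξ => ?_)
    rcases eq_or_ne ξ 0 with rfl | h
    · refine ContDiffAt.congr_of_eventuallyEq (f := fun _ => (0 : ℝ)) contDiffAt_const ?_
      filter_upwards [Metric.ball_mem_nhds (0 : EuclideanSpace ℝ (Fin n)) one_pos] with x hx
      have hx' : ‖x‖ < 1 := by simpa using hx
      rw [freqCutoff_eq_one (by linarith), freqCutoff_eq_one (by rw [norm_smul]; norm_num; linarith),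
        sub_self]
      exact zero_mul _
    · refine ContDiffAt.mul (ContDiffAt.sub (freqCutoff n).contDiffAt ?_) ?_
      · exact (freqCutoff n).contDiff.contDiffAt.comp ξ (contDiff_const_smul (2 : ℝ)).contDiffAt
      · exact (contDiffAt_norm ℝ h).rpow_const_of_ne (norm_ne_zero_iff.2 h)
  exact ⟨hcs.toSchwartzMap hsm, fun _ => rfl⟩

lemma norm_fourierInv_le (f : EuclideanSpace ℝ (Fin n) → ℂ) (x : EuclideanSpace ℝ (Fin n)) :
    ‖𝓕⁻ f x‖ ≤ ∫ ξ, ‖f ξ‖ :=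
  VectorFourier.norm_fourierIntegral_le_integral_norm _ _ _ _ _

lemma fourierInv_add {f g : EuclideanSpace ℝ (Fin n) → ℂ} (hf : Integrable f) (hg : Integrable g)
    (x : EuclideanSpace ℝ (Fin n)) :
    𝓕⁻ (fun ξ => f ξ + g ξ) x = 𝓕⁻ f x + 𝓕⁻ g x := by
  have hf' := (Real.fourierIntegral_convergent_iff (μ := volume) (f := f) (-x)).2 hf
  have hg' := (Real.fourierIntegral_convergent_iff (μ := volume) (f := g) (-x)).2 hg
  simp only [inner_neg_right, neg_neg] at hf' hg'
  simp only [Real.fourierInv_eq, smul_add]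
  exact integral_add hf' hg'

lemma fourierInv_const_mul (c : ℂ) (f : EuclideanSpace ℝ (Fin n) → ℂ)
    (x : EuclideanSpace ℝ (Fin n)) :
    𝓕⁻ (fun ξ => c * f ξ) x = c * 𝓕⁻ f x := by
  simp only [Real.fourierInv_eq, ← integral_const_mul, Circle.smul_def, smul_eq_mul]
  congr 1 with ξ
  ring

/-- The kernel of the low-frequency part decays like the weight: the symbol reproduces itself under
dilation by `2`, up to a Schwartz function. -/
lemma exists_fourierInv_lowFreq_le {σ : ℝ} (hσ : 1 ≤ σ) :
    ∃ A, ∀ x : EuclideanSpace ℝ (Fin n),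
      ‖𝓕⁻ (fun ξ : EuclideanSpace ℝ (Fin n) =>
        ((freqCutoff n ξ * ‖ξ‖ ^ (2 * σ) : ℝ) : ℂ)) x‖ ≤ A * polyWeight x := by
  set a : EuclideanSpace ℝ (Fin n) → ℂ := fun ξ => ((freqCutoff n ξ * ‖ξ‖ ^ (2 * σ) : ℝ) : ℂ)
  have ha : Integrable a := integrable_lowFreq (by linarith)
  obtain ⟨θ, hθ⟩ := exists_schwartz_annulus (n := n) σ
  obtain ⟨C, hC⟩ := exists_schwartz_le_polyWeight (𝓕⁻ θ)
  have h2 : (0 : ℝ) < 2 ^ (-(2 * σ)) := by positivity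
  refine le_polyWeight_of_dilation (a := 2 ^ (-(2 * σ)) * (2 ^ n)⁻¹) (B := ∫ ξ, ‖a ξ‖) (C := C)
    (by positivity) ?_ (norm_fourierInv_le a) fun x => ?_
  · calc (2 : ℝ) ^ (-(2 * σ)) * (2 ^ n)⁻¹ * 2 ^ (n + 1) = 2 * 2 ^ (-(2 * σ)) := by
          rw [pow_succ]; field_simp
      _ ≤ 2 * 2 ^ (-2 : ℝ) := by
          gcongr
          · norm_num
          · linarith
      _ = 1 / 2 := by
          rw [Real.rpow_neg (by norm_num)]; norm_num
  · have hdec : a = fun ξ => ((2 ^ (-(2 * σ)) : ℝ) : ℂ) * a ((2 : ℝ) • ξ) + θ ξ := by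
      funext ξ
      rw [hθ]
      simp only [a]
      rw [← Complex.ofReal_mul, ← Complex.ofReal_add, norm_smul, Real.norm_of_nonneg zero_le_two,
        Real.mul_rpow zero_le_two (norm_nonneg _), Real.rpow_neg zero_le_two]
      congr 1
      field_simp
      ring
    have ha2 : Integrable fun ξ => a ((2 : ℝ) • ξ) := ha.comp_smul two_ne_zero
    have e : 𝓕⁻ a x = ((2 ^ (-(2 * σ)) : ℝ) : ℂ) *
        ((((2 ^ n)⁻¹ : ℝ)) • 𝓕⁻ a ((2 : ℝ)⁻¹ • x)) + (𝓕⁻ θ) x := by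
      conv_lhs => rw [hdec]
      rw [fourierInv_add (ha2.const_mul _) θ.integrable, fourierInv_const_mul,
        fourierInv_comp_smul a two_pos, SchwartzMap.fourierInv_coe]
    rw [e]
    refine (norm_add_le _ _).trans (add_le_add (le_of_eq ?_) (hC x))
    rw [norm_mul, norm_smul, Complex.norm_real, Real.norm_of_nonneg h2.le,
      Real.norm_of_nonneg (by positivity), mul_assoc]

/-- The inverse transform of `‖ξ‖^{2σ} 𝓕 g` decays like the weight, for a Schwartz function `g`. -/
theorem exists_fourierInv_rpow_mul_le {σ : ℝ} (hσ : 1 ≤ σ)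
    (g : SchwartzMap (EuclideanSpace ℝ (Fin n)) ℂ) :
    Integrable (fun ξ => ((‖ξ‖ ^ (2 * σ) : ℝ) : ℂ) * 𝓕 (g : EuclideanSpace ℝ (Fin n) → ℂ) ξ) ∧
    ∃ A, ∀ x, ‖𝓕⁻ (fun ξ => ((‖ξ‖ ^ (2 * σ) : ℝ) : ℂ) *
      𝓕 (g : EuclideanSpace ℝ (Fin n) → ℂ) ξ) x‖ ≤ A * polyWeight x := by
  set a : EuclideanSpace ℝ (Fin n) → ℂ := fun ξ => ((freqCutoff n ξ * ‖ξ‖ ^ (2 * σ) : ℝ) : ℂ)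
    with ha_def
  have ha : Integrable a := integrable_lowFreq (by linarith)
  have hH := hasTemperateGrowth_highFreq (n := n) (σ := σ) (by linarith)
  set h : SchwartzMap (EuclideanSpace ℝ (Fin n)) ℂ := SchwartzMap.smulLeftCLM ℂ
    (fun ξ : EuclideanSpace ℝ (Fin n) => (((1 - freqCutoff n ξ) * ‖ξ‖ ^ (2 * σ) : ℝ) : ℂ)) (𝓕 g)
  have hh : ∀ ξ, h ξ = (((1 - freqCutoff n ξ) * ‖ξ‖ ^ (2 * σ) : ℝ) : ℂ) *
      𝓕 (g : EuclideanSpace ℝ (Fin n) → ℂ) ξ := fun ξ => by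
    simp only [h]
    rw [SchwartzMap.smulLeftCLM_apply_apply hH, SchwartzMap.fourier_coe, smul_eq_mul]
  have hsplit : (fun ξ => ((‖ξ‖ ^ (2 * σ) : ℝ) : ℂ) * 𝓕 (g : EuclideanSpace ℝ (Fin n) → ℂ) ξ) =
      fun ξ => a ξ * 𝓕 (g : EuclideanSpace ℝ (Fin n) → ℂ) ξ + h ξ := by
    funext ξ
    rw [hh, ← add_mul, ha_def]
    simp only [← Complex.ofReal_add]
    congr 2
    ring
  have hag : Integrable fun ξ => a ξ * 𝓕 (g : EuclideanSpace ℝ (Fin n) → ℂ) ξ := by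
    refine Integrable.mul_bdd (c := ∫ y, ‖g y‖) ha ?_ (Eventually.of_forall fun ξ => ?_)
    · rw [← SchwartzMap.fourier_coe]
      exact (𝓕 g).continuous.aestronglyMeasurable
    · exact VectorFourier.norm_fourierIntegral_le_integral_norm _ _ _ _ _
  rw [hsplit]
  refine ⟨hag.add h.integrable, ?_⟩
  obtain ⟨A, hA⟩ := exists_fourierInv_lowFreq_le (n := n) hσ
  obtain ⟨B, hB⟩ := exists_schwartz_le_polyWeight g
  obtain ⟨C, hC⟩ := exists_schwartz_le_polyWeight (𝓕⁻ h)
  refine ⟨B * A * (2 ^ (n + 2) * ∫ y : EuclideanSpace ℝ (Fin n), polyWeight y) + C, fun x => ?_⟩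
  rw [fourierInv_add hag h.integrable, fourierInv_mul_fourier ha g.integrable, add_mul]
  refine (norm_add_le _ _).trans (add_le_add (norm_integral_mul_le_polyWeight hB hA x) ?_)
  rw [← SchwartzMap.fourierInv_coe]
  exact hC x

end Decay

/-! ### The spatial test functions -/

section Spatial

variable {n : ℕ}

lemma fracLaplacian_const_mul (σ c : ℝ) (φ : EuclideanSpace ℝ (Fin n) → ℝ)
    (x : EuclideanSpace ℝ (Fin n)) :
    fracLaplacian σ (fun y => c * φ y) x = c * fracLaplacian σ φ x := by
  have h : ∀ ξ, 𝓕 (fun y : EuclideanSpace ℝ (Fin n) => ((c * φ y : ℝ) : ℂ)) ξ =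
      (c : ℂ) * 𝓕 (fun y : EuclideanSpace ℝ (Fin n) => (φ y : ℂ)) ξ := fun ξ => by
    simp only [Real.fourier_eq, ← integral_const_mul, Circle.smul_def, smul_eq_mul]
    congr 1 with v
    push_cast
    ring
  unfold fracLaplacian
  simp_rw [h, mul_left_comm _ (c : ℂ)]
  rw [fourierInv_const_mul, Complex.re_ofReal_mul]

lemma fracLaplacian_comp_smul (σ : ℝ) {R : ℝ} (hR : 0 < R) (φ : EuclideanSpace ℝ (Fin n) → ℝ)
    (x : EuclideanSpace ℝ (Fin n)) :
    fracLaplacian σ (fun y => φ (R⁻¹ • y)) x =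
      (R ^ (2 * σ))⁻¹ * fracLaplacian σ φ (R⁻¹ • x) := by
  set F : EuclideanSpace ℝ (Fin n) → ℂ := fun ξ => (((2 * Real.pi * ‖ξ‖) ^ (2 * σ) : ℝ) : ℂ) *
    𝓕 (fun y : EuclideanSpace ℝ (Fin n) => (φ y : ℂ)) ξ with hF
  have h : (fun ξ : EuclideanSpace ℝ (Fin n) => (((2 * Real.pi * ‖ξ‖) ^ (2 * σ) : ℝ) : ℂ) *
      𝓕 (fun y : EuclideanSpace ℝ (Fin n) => (φ (R⁻¹ • y) : ℂ)) ξ) =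
      fun ξ => ((R ^ n * (R ^ (2 * σ))⁻¹ : ℝ) : ℂ) * F (R • ξ) := by
    funext ξ
    rw [fourier_comp_smul (fun y : EuclideanSpace ℝ (Fin n) => (φ y : ℂ)) (inv_pos.2 hR), hF]
    simp only [inv_inv, norm_smul, Real.norm_of_nonneg hR.le, inv_pow, Complex.real_smul]
    rw [show 2 * Real.pi * (R * ‖ξ‖) = R * (2 * Real.pi * ‖ξ‖) by ring,
      Real.mul_rpow hR.le (by positivity)]
    have : ((R ^ (2 * σ) : ℝ) : ℂ) ≠ 0 := Complex.ofReal_ne_zero.2 (by positivity)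
    push_cast
    field_simp
  unfold fracLaplacian
  rw [h, fourierInv_const_mul, fourierInv_comp_smul F hR, Complex.re_ofReal_mul, Complex.smul_re,
    smul_eq_mul, ← mul_assoc]
  congr 1
  field_simp

/-- A nonnegative weight `φ` on `ℝⁿ` with an approximation `φm` from below by nonnegative functions
of class `C_c^∞` whose fractional Laplacians are dominated by `K φ`, uniformly along the
approximation. (For non-integer `σ` the operator is not local, so that a compactly supported
function cannot be expected to dominate its own fractional Laplacian.) -/
structure IsTestProfile (σ : ℝ) (φ : EuclideanSpace ℝ (Fin n) → ℝ)
    (φm : ℕ → EuclideanSpace ℝ (Fin n) → ℝ) (K : ℝ) : Prop where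
  continuous : Continuous φ
  pos : ∀ x, 0 < φ x
  integrable : Integrable φ
  bounded : ∀ x, φ x ≤ K
  contDiff : ∀ m, ContDiff ℝ ∞ (φm m)
  hasCompactSupport : ∀ m, HasCompactSupport (φm m)
  nonneg : ∀ m x, 0 ≤ φm m x
  le : ∀ m x, φm m x ≤ φ x
  tendsto : ∀ x, Tendsto (fun m => φm m x) atTop (𝓝 (φ x))
  fracLaplacian_le : ∀ m x, |fracLaplacian σ (φm m) x| ≤ K * φ x

lemma IsTestProfile.const_pos {σ K : ℝ} {φ : EuclideanSpace ℝ (Fin n) → ℝ}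
    {φm : ℕ → EuclideanSpace ℝ (Fin n) → ℝ} (h : IsTestProfile σ φ φm K) : 0 < K :=
  (h.pos 0).trans_le (h.bounded 0)

/-- A smooth cutoff, equal to `1` for `‖x‖ ≤ 1` and to `0` for `2 ≤ ‖x‖`. -/
noncomputable def spaceBump (n : ℕ) : ContDiffBump (0 : EuclideanSpace ℝ (Fin n)) where
  rIn := 1
  rOut := 2
  rIn_pos := by norm_num
  rIn_lt_rOut := by norm_num

/-- The polynomial weight, mollified by a bump function. -/
noncomputable def smoothWeight (x : EuclideanSpace ℝ (Fin n)) : ℝ :=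
  ∫ y, polyWeight y * spaceBump n (x - y)

/-- The polynomial weight, truncated to the ball of radius `m` and mollified. -/
noncomputable def truncWeight (m : ℕ) (x : EuclideanSpace ℝ (Fin n)) : ℝ :=
  ∫ y, (Metric.closedBall 0 (m : ℝ)).indicator polyWeight y * spaceBump n (x - y)

lemma indicator_polyWeight_nonneg (m : ℕ) (y : EuclideanSpace ℝ (Fin n)) :
    0 ≤ (Metric.closedBall 0 (m : ℝ)).indicator polyWeight y :=
  indicator_nonneg (fun x _ => (polyWeight_pos x).le) y

lemma indicator_polyWeight_le (m : ℕ) (y : EuclideanSpace ℝ (Fin n)) :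
    (Metric.closedBall 0 (m : ℝ)).indicator polyWeight y ≤ polyWeight y :=
  indicator_le_self' (fun x _ => (polyWeight_pos x).le) y

lemma integrable_indicator_polyWeight (m : ℕ) :
    Integrable ((Metric.closedBall (0 : EuclideanSpace ℝ (Fin n)) (m : ℝ)).indicator polyWeight) :=
  integrable_polyWeight.indicator measurableSet_closedBall

lemma integrable_mul_bump {f : EuclideanSpace ℝ (Fin n) → ℝ} (hf : Integrable f)
    (x : EuclideanSpace ℝ (Fin n)) : Integrable fun y => f y * spaceBump n (x - y) := by
  refine hf.mul_bdd (c := 1) ?_ (Eventually.of_forall fun y => ?_)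
  · exact ((spaceBump n).continuous.comp (by fun_prop)).aestronglyMeasurable
  · rw [Real.norm_of_nonneg (spaceBump n).nonneg]
    exact (spaceBump n).le_one

lemma smoothWeight_eq_convolution :
    smoothWeight (n := n) = convolution polyWeight (spaceBump n)
      (ContinuousLinearMap.mul ℝ ℝ) volume := rfl

lemma truncWeight_eq_convolution (m : ℕ) :
    truncWeight (n := n) m = convolution ((Metric.closedBall 0 (m : ℝ)).indicator polyWeight)
      (spaceBump n) (ContinuousLinearMap.mul ℝ ℝ) volume := rfl

/-- The mollified weight is comparable to the weight from below. -/
lemma exists_polyWeight_le_smoothWeight :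
    ∃ c > 0, ∀ x : EuclideanSpace ℝ (Fin n), c * polyWeight x ≤ smoothWeight x := by
  set v := volume.real (Metric.closedBall (0 : EuclideanSpace ℝ (Fin n)) 1) with hv
  have hv0 : 0 < v := ENNReal.toReal_pos
    (Metric.measure_closedBall_pos volume _ one_pos).ne' measure_closedBall_lt_top.ne
  refine ⟨v * (2 ^ (n + 1))⁻¹, by positivity, fun x => ?_⟩
  have hvx : volume.real (Metric.closedBall x 1) = v := by
    rw [hv, measureReal_def, measureReal_def, Measure.addHaar_closedBall_center]
  calc v * (2 ^ (n + 1))⁻¹ * polyWeight x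
      = ∫ y in Metric.closedBall x 1, (2 ^ (n + 1))⁻¹ * polyWeight x := by
        rw [setIntegral_const, hvx, smul_eq_mul, mul_assoc]
    _ ≤ ∫ y in Metric.closedBall x 1, polyWeight y * spaceBump n (x - y) := by
        refine setIntegral_mono_on (integrableOn_const measure_closedBall_lt_top.ne)
          (integrable_mul_bump integrable_polyWeight x).integrableOn measurableSet_closedBall
          fun y hy => ?_
        have hxy : ‖x - y‖ ≤ 1 := by rw [norm_sub_rev, ← dist_eq_norm]; exact hy
        rw [(spaceBump n).one_of_mem_closedBall (by simpa [spaceBump] using hxy), mul_one,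
          ← div_eq_inv_mul, div_le_iff₀' (by positivity)]
        refine polyWeight_le_of_norm_le ?_
        have := norm_le_norm_add_norm_sub x y
        linarith [norm_nonneg x]
    _ ≤ smoothWeight x := by
        refine setIntegral_le_integral (integrable_mul_bump integrable_polyWeight x)
          (Eventually.of_forall fun y => ?_)
        exact mul_nonneg (polyWeight_pos y).le (spaceBump n).nonneg

/-- The fractional Laplacian of the truncated weight is the convolution of the truncated
polynomial weight with a kernel that decays like the weight, so that its bound by the weight does
not depend on the truncation. -/
lemma exists_fracLaplacian_truncWeight_le {σ : ℝ} (hσ : 1 ≤ σ) :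
    ∃ C, 0 ≤ C ∧ ∀ (m : ℕ) (x : EuclideanSpace ℝ (Fin n)),
      |fracLaplacian σ (truncWeight m) x| ≤ C * polyWeight x := by
  have hcs : HasCompactSupport fun x => (spaceBump n x : ℂ) :=
    (spaceBump n).hasCompactSupport.comp_left Complex.ofReal_zero
  have hsm : ContDiff ℝ ∞ fun x => (spaceBump n x : ℂ) :=
    Complex.ofRealCLM.contDiff.comp (spaceBump n).contDiff
  obtain ⟨hint, A, hA⟩ := exists_fourierInv_rpow_mul_le hσ (hcs.toSchwartzMap hsm)
  have hg : ((hcs.toSchwartzMap hsm : SchwartzMap (EuclideanSpace ℝ (Fin n)) ℂ) :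
      EuclideanSpace ℝ (Fin n) → ℂ) = fun x => (spaceBump n x : ℂ) := rfl
  rw [hg] at hint hA
  have hgi : Integrable fun x => (spaceBump n x : ℂ) :=
    hsm.continuous.integrable_of_hasCompactSupport hcs
  set C := (2 * Real.pi) ^ (2 * σ) *
    (1 * A * (2 ^ (n + 2) * ∫ y : EuclideanSpace ℝ (Fin n), polyWeight y)) with hC
  have key : ∀ (m : ℕ) (x : EuclideanSpace ℝ (Fin n)),
      |fracLaplacian σ (truncWeight m) x| ≤ C * polyWeight x := by
    intro m x
    set f : EuclideanSpace ℝ (Fin n) → ℂ := fun y =>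
      (((Metric.closedBall 0 (m : ℝ)).indicator polyWeight y : ℝ) : ℂ) with hf
    have hfi : Integrable f := (integrable_indicator_polyWeight m).ofReal
    have hfb : ∀ y, ‖f y‖ ≤ 1 * polyWeight y := fun y => by
      rw [hf, Complex.norm_real, Real.norm_of_nonneg (indicator_polyWeight_nonneg m y), one_mul]
      exact indicator_polyWeight_le m y
    have hconv : (fun y => ((truncWeight m y : ℝ) : ℂ)) =
        convolution f (fun x => (spaceBump n x : ℂ)) (ContinuousLinearMap.mul ℂ ℂ) volume := by
      funext y
      simp only [truncWeight, convolution_def, ContinuousLinearMap.mul_apply', hf,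
        ← Complex.ofReal_mul]
      exact integral_ofReal.symm
    have hsym : (fun ξ : EuclideanSpace ℝ (Fin n) => (((2 * Real.pi * ‖ξ‖) ^ (2 * σ) : ℝ) : ℂ) *
        𝓕 (fun y : EuclideanSpace ℝ (Fin n) => ((truncWeight m y : ℝ) : ℂ)) ξ) =
        fun ξ => (((2 * Real.pi) ^ (2 * σ) : ℝ) : ℂ) *
          ((((‖ξ‖ ^ (2 * σ) : ℝ) : ℂ) * 𝓕 (fun x => (spaceBump n x : ℂ)) ξ) * 𝓕 f ξ) := by
      funext ξ
      rw [hconv, Real.fourier_mul_convolution_eq hfi hgi,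
        Real.mul_rpow (by positivity) (norm_nonneg _)]
      push_cast
      ring
    unfold fracLaplacian
    refine (Complex.abs_re_le_norm _).trans ?_
    rw [hsym, fourierInv_const_mul, fourierInv_mul_fourier hint hfi, norm_mul, Complex.norm_real,
      Real.norm_of_nonneg (by positivity), hC, mul_assoc]
    exact mul_le_mul_of_nonneg_left (norm_integral_mul_le_polyWeight hfb hA x) (by positivity)
  exact ⟨C, nonneg_of_mul_nonneg_left ((abs_nonneg _).trans (key 0 0)) (polyWeight_pos 0), key⟩

theorem exists_isTestProfile (n : ℕ) {σ : ℝ} (hσ : 1 ≤ σ) :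
    ∃ (φ : EuclideanSpace ℝ (Fin n) → ℝ) (φm : ℕ → EuclideanSpace ℝ (Fin n) → ℝ) (K : ℝ),
      IsTestProfile σ φ φm K := by
  obtain ⟨c, hc, hcφ⟩ := exists_polyWeight_le_smoothWeight (n := n)
  obtain ⟨C, hC0, hC⟩ := exists_fracLaplacian_truncWeight_le (n := n) hσ
  set I := ∫ y : EuclideanSpace ℝ (Fin n), polyWeight y
  have hbump : Integrable (spaceBump n) :=
    (spaceBump n).continuous.integrable_of_hasCompactSupport (spaceBump n).hasCompactSupport
  refine ⟨smoothWeight, truncWeight, max I (C / c), ?_, fun x => ?_, ?_, fun x => ?_, fun m => ?_,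
    fun m => ?_, fun m x => ?_, fun m x => ?_, fun x => ?_, fun m x => ?_⟩
  · rw [smoothWeight_eq_convolution]
    exact (spaceBump n).hasCompactSupport.continuous_convolution_right _
      integrable_polyWeight.locallyIntegrable (spaceBump n).continuous
  · exact lt_of_lt_of_le (mul_pos hc (polyWeight_pos x)) (hcφ x)
  · rw [smoothWeight_eq_convolution]
    exact integrable_polyWeight.integrable_convolution _ hbump
  · refine le_trans ?_ (le_max_left _ _)
    refine integral_mono (integrable_mul_bump integrable_polyWeight x) integrable_polyWeight
      fun y => ?_
    exact mul_le_of_le_one_right (polyWeight_pos y).le (spaceBump n).le_one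
  · rw [truncWeight_eq_convolution]
    exact (spaceBump n).hasCompactSupport.contDiff_convolution_right _
      (integrable_indicator_polyWeight m).locallyIntegrable (spaceBump n).contDiff
  · rw [truncWeight_eq_convolution]
    refine HasCompactSupport.convolution _ ?_ (spaceBump n).hasCompactSupport
    exact HasCompactSupport.intro (isCompact_closedBall 0 (m : ℝ))
      fun x hx => indicator_of_notMem hx _
  · exact integral_nonneg fun y =>
      mul_nonneg (indicator_polyWeight_nonneg m y) (spaceBump n).nonneg
  · refine integral_mono (integrable_mul_bump (integrable_indicator_polyWeight m) x)
      (integrable_mul_bump integrable_polyWeight x) fun y => ?_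
    exact mul_le_mul_of_nonneg_right (indicator_polyWeight_le m y) (spaceBump n).nonneg
  · refine tendsto_integral_of_dominated_convergence _
      (fun m => (integrable_mul_bump (integrable_indicator_polyWeight m) x).aestronglyMeasurable)
      integrable_polyWeight (fun m => Eventually.of_forall fun y => ?_)
      (Eventually.of_forall fun y => ?_)
    · rw [Real.norm_of_nonneg
        (mul_nonneg (indicator_polyWeight_nonneg m y) (spaceBump n).nonneg)]
      exact (mul_le_of_le_one_right (indicator_polyWeight_nonneg m y) (spaceBump n).le_one).trans
        (indicator_polyWeight_le m y)
    · refine tendsto_const_nhds.congr' ?_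
      obtain ⟨k, hk⟩ := exists_nat_ge ‖y‖
      filter_upwards [eventually_ge_atTop k] with m hm
      have hy : y ∈ Metric.closedBall (0 : EuclideanSpace ℝ (Fin n)) (m : ℝ) := by
        rw [mem_closedBall_zero_iff]
        exact hk.trans (by exact_mod_cast hm)
      rw [indicator_of_mem hy]
  · have hpos : 0 ≤ smoothWeight x := (mul_pos hc (polyWeight_pos x)).le.trans (hcφ x)
    calc |fracLaplacian σ (truncWeight m) x| ≤ C * polyWeight x := hC m x
      _ = C / c * (c * polyWeight x) := by field_simp
      _ ≤ C / c * smoothWeight x := by gcongr; exact hcφ x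
      _ ≤ max I (C / c) * smoothWeight x := by gcongr; exact le_max_right _ _

end Spatial

/-! ### The time cutoff -/

section Time

variable {ι : Type*}

/-- A cutoff `ψ` in time with `ψ = 1` to first order at `t = 0` and vanishing for `t ≥ 1/2`, whose
first two derivatives are dominated by `M ψ^{1/q}` for all exponents `q` of a given family. -/
structure IsTimeCutoff (q : ι → ℝ) (ψ : ℝ → ℝ) (M : ℝ) : Prop where
  contDiff : ContDiff ℝ ∞ ψ
  tsupport_subset : tsupport ψ ⊆ Icc (-(1 / 2)) (1 / 2)
  nonneg : ∀ t, 0 ≤ ψ t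
  le_one : ∀ t, ψ t ≤ 1
  zero : ψ 0 = 1
  deriv_zero : deriv ψ 0 = 0
  abs_deriv_le : ∀ l t, |deriv ψ t| ≤ M * ψ t ^ (1 / q l)
  abs_deriv_deriv_le : ∀ l t, |deriv (deriv ψ) t| ≤ M * ψ t ^ (1 / q l)

lemma IsTimeCutoff.const_nonneg {q : ι → ℝ} {ψ : ℝ → ℝ} {M : ℝ} (h : IsTimeCutoff q ψ M) (l : ι) :
    0 ≤ M := by
  have := (abs_nonneg _).trans (h.abs_deriv_le l 0)
  simpa [h.zero] using this

/-- A high power of a bump function is a time cutoff: differentiating `b ^ (N + 2)` twice leaves a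
factor `b ^ N`, and `N` is so large that `b ^ N ≤ b ^ ((N + 2) / q)`. -/
theorem exists_isTimeCutoff [Finite ι] (q : ι → ℝ) (hq : ∀ l, 1 < q l) :
    ∃ ψ M, IsTimeCutoff q ψ M := by
  let b : ContDiffBump (0 : ℝ) :=
    { rIn := 1 / 4, rOut := 1 / 2, rIn_pos := by norm_num, rIn_lt_rOut := by norm_num }
  have hb : ContDiff ℝ ∞ b := b.contDiff
  have hb' : ContDiff ℝ ∞ (deriv b) := (contDiff_infty_iff_deriv.1 hb).2
  have hbd : ∀ t, HasDerivAt b (deriv b t) t := fun t =>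
    (hb.differentiable (by simp) t).hasDerivAt
  have hbd' : ∀ t, HasDerivAt (deriv b) (deriv (deriv b) t) t := fun t =>
    (hb'.differentiable (by simp) t).hasDerivAt
  obtain ⟨D, hD⟩ := b.hasCompactSupport.deriv.exists_bound_of_continuous hb'.continuous
  obtain ⟨D', hD'⟩ := b.hasCompactSupport.deriv.deriv.exists_bound_of_continuous
    (contDiff_infty_iff_deriv.1 hb').2.continuous
  have hD0 : 0 ≤ D := (norm_nonneg _).trans (hD 0)
  have hD0' : 0 ≤ D' := (norm_nonneg _).trans (hD' 0)
  obtain ⟨N, hN⟩ : ∃ N : ℕ, ∀ l, 2 / (q l - 1) ≤ N := by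
    obtain ⟨c, hc⟩ := (Set.finite_range fun l => 2 / (q l - 1)).bddAbove
    obtain ⟨N, hN⟩ := exists_nat_ge c
    exact ⟨N, fun l => (hc ⟨l, rfl⟩).trans hN⟩
  have hpow : ∀ l t, b t ^ N ≤ (b t ^ (N + 2)) ^ (1 / q l) := by
    intro l t
    have hq0 : 0 < q l := by linarith [hq l]
    have hexp : ((N + 2 : ℕ) : ℝ) * (1 / q l) ≤ N := by
      have := hN l
      rw [div_le_iff₀ (by linarith [hq l])] at this
      rw [mul_one_div, div_le_iff₀ hq0]
      push_cast
      linarith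
    rw [← Real.rpow_natCast (b t) (N + 2), ← Real.rpow_mul b.nonneg]
    rcases (b.nonneg (x := t)).eq_or_lt with h0 | h0
    · rw [← h0, Real.zero_rpow (by positivity)]
      have hN0 : N ≠ 0 := by
        rintro rfl
        have : 0 < 2 / (q l - 1) := div_pos two_pos (by linarith [hq l])
        have := hN l
        simp only [Nat.cast_zero] at this
        linarith
      rw [zero_pow hN0]
    · rw [← Real.rpow_natCast (b t) N]
      exact Real.rpow_le_rpow_of_exponent_ge h0 b.le_one hexp
  have hd : ∀ t, HasDerivAt (fun t => b t ^ (N + 2)) ((N + 2) * b t ^ (N + 1) * deriv b t) t :=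
    fun t => by
      have := (hbd t).fun_pow (N + 2)
      exact this.congr_deriv (by push_cast; rfl)
  have hd1 : deriv (fun t => b t ^ (N + 2)) = fun t => (N + 2) * b t ^ (N + 1) * deriv b t :=
    funext fun t => (hd t).deriv
  have hd2 : ∀ t, deriv (deriv fun t => b t ^ (N + 2)) t =
      (N + 2) * b t ^ N * ((N + 1) * deriv b t ^ 2 + b t * deriv (deriv b) t) := fun t => by
    rw [hd1]
    have := (((hbd t).fun_pow (N + 1)).const_mul (N + 2 : ℝ)).mul (hbd' t)
    refine Eq.trans this.deriv ?_
    push_cast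
    ring
  refine ⟨fun t => b t ^ (N + 2), (N + 2) * (D + (N + 1) * D ^ 2 + D'), ?_⟩
  have hb0 : b 0 = 1 := b.one_of_mem_closedBall (by simp [b])
  have hbd0 : deriv b 0 = 0 := by
    have : (b : ℝ → ℝ) =ᶠ[𝓝 0] fun _ => 1 := b.eventuallyEq_one
    rw [this.deriv_eq]; simp
  refine ⟨hb.pow _, ?_, fun t => pow_nonneg b.nonneg _, fun t => pow_le_one₀ b.nonneg b.le_one,
    by simp [hb0], by rw [hd1]; simp [hbd0], fun l t => ?_, fun l t => ?_⟩
  · refine closure_minimal (fun t ht => ?_) isClosed_Icc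
    by_contra hcon
    refine ht ?_
    have : b.rOut ≤ dist t 0 := by
      rw [Real.dist_eq, sub_zero]
      by_contra h
      have := abs_lt.1 (not_le.1 h)
      exact hcon ⟨this.1.le, this.2.le⟩
    simp [b.zero_of_le_dist this]
  · have hbN : 0 ≤ b t ^ N := pow_nonneg b.nonneg _
    have h1 : b t ^ (N + 1) ≤ b t ^ N := pow_le_pow_of_le_one b.nonneg b.le_one (Nat.le_succ N)
    have h2 : 0 ≤ b t ^ (N + 1) := pow_nonneg b.nonneg _
    have h3 := hD t
    rw [Real.norm_eq_abs] at h3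
    rw [hd1]
    simp only [abs_mul, abs_of_nonneg h2, abs_of_nonneg (show (0 : ℝ) ≤ N + 2 by positivity)]
    calc (N + 2) * b t ^ (N + 1) * |deriv b t| ≤ (N + 2) * b t ^ N * D := by gcongr
      _ = (N + 2) * D * b t ^ N := by ring
      _ ≤ (N + 2) * (D + (N + 1) * D ^ 2 + D') * (b t ^ (N + 2)) ^ (1 / q l) := by
        gcongr
        · have : 0 ≤ (N + 1) * D ^ 2 := by positivity
          linarith
        · exact hpow l t
  · have h1 : 0 ≤ b t ^ N := pow_nonneg b.nonneg _
    have h3 := hD t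
    have h4 := hD' t
    rw [Real.norm_eq_abs] at h3 h4
    rw [hd2, abs_mul, abs_mul, abs_of_nonneg h1,
      abs_of_nonneg (show (0 : ℝ) ≤ N + 2 by positivity)]
    have h5 : |(N + 1) * deriv b t ^ 2 + b t * deriv (deriv b) t| ≤ (N + 1) * D ^ 2 + D' := by
      refine (abs_add_le _ _).trans (add_le_add ?_ ?_)
      · rw [abs_mul, abs_of_nonneg (show (0 : ℝ) ≤ N + 1 by positivity), abs_pow]
        gcongr
      · rw [abs_mul, abs_of_nonneg b.nonneg]
        calc b t * |deriv (deriv b) t| ≤ 1 * D' := by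
              gcongr
              exact b.le_one
          _ = D' := one_mul _
    calc (N + 2) * b t ^ N * |(N + 1) * deriv b t ^ 2 + b t * deriv (deriv b) t|
        ≤ (N + 2) * b t ^ N * ((N + 1) * D ^ 2 + D') := by gcongr
      _ = (N + 2) * ((N + 1) * D ^ 2 + D') * b t ^ N := by ring
      _ ≤ (N + 2) * (D + (N + 1) * D ^ 2 + D') * (b t ^ (N + 2)) ^ (1 / q l) := by
        gcongr
        · linarith
        · exact hpow l t

end Time

/-! ### The exponents and the cyclic system of inequalities -/

section Algebra

variable {k : ℕ}

lemma expMatrix_mulVec (p v : Fin k → ℝ) (l : Fin k) :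
    (expMatrix p).mulVec v (finRotate k l) = p (finRotate k l) * v l := by
  simp [expMatrix, Matrix.mulVec, dotProduct]

/-- `P - I` is invertible: at an index where `|v|` is maximal, `P v = v` forces `v = 0`, because
all entries of `P` exceed `1`. -/
lemma isUnit_det_expMatrix_sub_one (p : Fin k → ℝ) (hp : ∀ l, 1 < p l) :
    IsUnit (expMatrix p - 1).det := by
  rw [isUnit_iff_ne_zero]
  intro hdet
  obtain ⟨v, hv0, hv⟩ := Matrix.exists_mulVec_eq_zero_iff.2 hdet
  have hv' : ∀ l, p (finRotate k l) * v l = v (finRotate k l) := fun l => by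
    have := congrFun hv (finRotate k l)
    rw [Matrix.sub_mulVec, Pi.sub_apply, expMatrix_mulVec, Matrix.one_mulVec] at this
    simpa [sub_eq_zero] using this
  obtain ⟨i, hi⟩ := Function.ne_iff.1 hv0
  have : Nonempty (Fin k) := ⟨i⟩
  obtain ⟨j, hj⟩ := Finite.exists_max fun l => |v l|
  have h1 := congrArg abs (hv' j)
  rw [abs_mul, abs_of_pos (by linarith [hp (finRotate k j)])] at h1
  have h2 := hj (finRotate k j)
  have h3 : 0 < |v j| := (abs_pos.2 hi).trans_le (hj i)
  nlinarith [hp (finRotate k j)]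

lemma gammaVec_eq (p : Fin k → ℝ) (hp : ∀ l, 1 < p l) (l : Fin k) :
    p (finRotate k l) * gammaVec p l = 1 + gammaVec p (finRotate k l) := by
  have h : (expMatrix p - 1).mulVec (gammaVec p) = fun _ => 1 := by
    rw [gammaVec, Matrix.mulVec_mulVec, Matrix.mul_nonsing_inv _ (isUnit_det_expMatrix_sub_one p hp),
      Matrix.one_mulVec]
  have := congrFun h (finRotate k l)
  rw [Matrix.sub_mulVec, Pi.sub_apply, expMatrix_mulVec, Matrix.one_mulVec] at this
  linarith

/-- A cyclic system `w_j ^ {q_j} ≤ K w_{j+1}` with superlinear powers bounds `w`; only the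
inequality at a maximal component is needed. -/
lemma exists_bound_of_cyclic (q : Fin k → ℝ) (hq : ∀ l, 1 < q l) {K : ℝ} (hK : 0 < K) :
    ∃ C > 0, ∀ w : Fin k → ℝ, (∀ j, 0 ≤ w j) →
      (∀ j, w j ^ q j ≤ K * w (finRotate k j)) → ∀ j, w j ≤ C := by
  refine ⟨∑ j, K ^ (1 / (q j - 1)) + 1, by positivity, fun w hw h j => ?_⟩
  have : Nonempty (Fin k) := ⟨j⟩
  obtain ⟨i, hi⟩ := Finite.exists_max w
  refine (hi j).trans ?_
  have hsum : K ^ (1 / (q i - 1)) ≤ ∑ j, K ^ (1 / (q j - 1)) :=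
    Finset.single_le_sum (f := fun j => K ^ (1 / (q j - 1))) (fun _ _ => by positivity)
      (Finset.mem_univ i)
  have hq1 : 0 < q i - 1 := by linarith [hq i]
  rcases (hw i).eq_or_lt with h0 | h0
  · rw [← h0]
    positivity
  · have h1 : w i ^ (q i - 1) ≤ K := by
      rw [Real.rpow_sub_one h0.ne', div_le_iff₀ h0]
      exact (h i).trans (by gcongr; exact hi _)
    have h2 : w i ≤ K ^ (1 / (q i - 1)) := by
      calc w i = (w i ^ (q i - 1)) ^ (1 / (q i - 1)) := by
            rw [← Real.rpow_mul h0.le, mul_one_div_cancel hq1.ne', Real.rpow_one]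
        _ ≤ _ := Real.rpow_le_rpow (by positivity) h1 (by positivity)
    linarith

/-- The scaling argument. The quantities `w_j = T^{γ_j - (1 + ν)} S_j` satisfy a cyclic system of
inequalities in which `T` does not appear, so that they are bounded, while the data force
`w_i ≥ c ε T^{γ_i - ν}`. -/
lemma exists_le_rpow_of_cyclic (q γ : Fin k → ℝ) (hq : ∀ l, 1 < q l)
    (hγ : ∀ l, q l * γ l = 1 + γ (finRotate k l)) (i : Fin k) {ν B δ I : ℝ} (hν : ν < γ i)
    (hB : 0 < B) (hδ : 0 < δ) (hI : 0 < I) :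
    ∃ C > 0, ∀ (ε T : ℝ) (S : Fin k → ℝ), 0 < ε → 0 < T → (∀ j, 0 ≤ S j) →
      ε * δ ≤ B * T⁻¹ * S i →
      (∀ j, S j ^ q j ≤ B * T⁻¹ * S (finRotate k j) * (I * T ^ (1 + ν)) ^ (q j - 1)) →
      T ≤ C * ε ^ (-(1 / (γ i - ν))) := by
  have hK : 0 < ∑ j, B * I ^ (q j - 1) :=
    Finset.sum_pos (fun j _ => by positivity) ⟨i, Finset.mem_univ i⟩
  obtain ⟨C, hC, hCw⟩ := exists_bound_of_cyclic q hq hK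
  refine ⟨(C * B / δ) ^ (1 / (γ i - ν)), by positivity, fun ε T S hε hT hS hdata hcyc => ?_⟩
  set w : Fin k → ℝ := fun j => T ^ (γ j - (1 + ν)) * S j with hw
  have hwi : w i ≤ C := by
    refine hCw w (fun j => mul_nonneg (by positivity) (hS j)) (fun j => ?_) i
    have hsum : B * I ^ (q j - 1) ≤ ∑ j, B * I ^ (q j - 1) :=
      Finset.single_le_sum (f := fun j => B * I ^ (q j - 1)) (fun _ _ => by positivity)
        (Finset.mem_univ j)
    have hwr : 0 ≤ w (finRotate k j) := mul_nonneg (by positivity) (hS _)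
    calc w j ^ q j = T ^ ((γ j - (1 + ν)) * q j) * S j ^ q j := by
          rw [hw]
          simp only
          rw [Real.mul_rpow (by positivity) (hS j), ← Real.rpow_mul hT.le]
      _ ≤ T ^ ((γ j - (1 + ν)) * q j) *
          (B * T⁻¹ * S (finRotate k j) * (I * T ^ (1 + ν)) ^ (q j - 1)) := by
          gcongr
          exact hcyc j
      _ = B * I ^ (q j - 1) * (T ^ ((γ j - (1 + ν)) * q j) * T ^ (-1 : ℝ) *
          T ^ ((1 + ν) * (q j - 1))) * S (finRotate k j) := by
          rw [Real.mul_rpow hI.le (by positivity), ← Real.rpow_mul hT.le, Real.rpow_neg_one]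
          ring
      _ = B * I ^ (q j - 1) * w (finRotate k j) := by
          rw [← Real.rpow_add hT, ← Real.rpow_add hT, hw]
          simp only
          rw [show (γ j - (1 + ν)) * q j + -1 + (1 + ν) * (q j - 1) =
            γ (finRotate k j) - (1 + ν) by linarith [hγ j]]
          ring
      _ ≤ _ := by gcongr
  have ha : 0 < γ i - ν := sub_pos.2 hν
  have hlow : δ / B * ε * T ^ (γ i - ν) ≤ w i := by
    have h1 : δ / B * ε * T ≤ S i := by
      rw [← div_eq_mul_inv, div_mul_eq_mul_div, le_div_iff₀ hT] at hdata
      rw [div_mul_eq_mul_div, div_mul_eq_mul_div, div_le_iff₀ hB]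
      linarith
    calc δ / B * ε * T ^ (γ i - ν) = T ^ (γ i - (1 + ν)) * (δ / B * ε * T) := by
          rw [show γ i - ν = (γ i - (1 + ν)) + 1 by ring, Real.rpow_add_one hT.ne']
          ring
      _ ≤ w i := by
          rw [hw]
          simp only
          gcongr
  have hfin : T ^ (γ i - ν) ≤ (C * B / δ) * ε⁻¹ := by
    have h := hlow.trans hwi
    rw [← div_eq_mul_inv, le_div_iff₀ hε, le_div_iff₀ hδ]
    rw [div_mul_eq_mul_div, div_mul_eq_mul_div, div_le_iff₀ hB] at h
    linarith
  calc T = (T ^ (γ i - ν)) ^ (1 / (γ i - ν)) := by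
        rw [← Real.rpow_mul hT.le, mul_one_div_cancel ha.ne', Real.rpow_one]
    _ ≤ ((C * B / δ) * ε⁻¹) ^ (1 / (γ i - ν)) :=
        Real.rpow_le_rpow (by positivity) hfin (by positivity)
    _ = _ := by
        rw [Real.mul_rpow (by positivity) (by positivity), Real.inv_rpow hε.le, Real.rpow_neg hε.le]

end Algebra

/-! ### Space-time test functions -/

section TestFun

variable {n : ℕ}

/-- The product test function `ψ(t / T) χ(x / R)`. -/
noncomputable def prodTest (ψ : ℝ → ℝ) (χ : EuclideanSpace ℝ (Fin n) → ℝ) (T R : ℝ) :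
    ℝ → EuclideanSpace ℝ (Fin n) → ℝ :=
  fun t x => ψ (T⁻¹ * t) * χ (R⁻¹ • x)

lemma tsupport_prodTest_subset {ψ : ℝ → ℝ} {χ : EuclideanSpace ℝ (Fin n) → ℝ} {T R : ℝ}
    (hψ : tsupport ψ ⊆ Icc (-(1 / 2)) (1 / 2)) (hχ : HasCompactSupport χ) (hT : 0 < T)
    (hR : 0 < R) :
    tsupport (fun z : ℝ × EuclideanSpace ℝ (Fin n) => prodTest ψ χ T R z.1 z.2) ⊆
      Icc (-(T / 2)) (T / 2) ×ˢ ((fun x => R • x) '' tsupport χ) := by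
  have hK : IsCompact ((fun x => R • x) '' tsupport χ) := hχ.isCompact.image (continuous_const_smul R)
  refine closure_minimal ?_ (isClosed_Icc.prod hK.isClosed)
  rintro ⟨t, x⟩ hz
  have h1 : ψ (T⁻¹ * t) ≠ 0 := left_ne_zero_of_mul hz
  have h2 : χ (R⁻¹ • x) ≠ 0 := right_ne_zero_of_mul hz
  have h3 := hψ (subset_tsupport _ h1)
  refine ⟨⟨?_, ?_⟩, ⟨R⁻¹ • x, subset_tsupport _ h2, smul_inv_smul₀ hR.ne' x⟩⟩
  · have := h3.1
    rw [← div_eq_inv_mul, le_div_iff₀ hT] at this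
    simp only
    linarith
  · have := h3.2
    rw [← div_eq_inv_mul, div_le_iff₀ hT] at this
    simp only
    linarith

lemma isTestFunction_prodTest {ψ : ℝ → ℝ} {χ : EuclideanSpace ℝ (Fin n) → ℝ} {T R : ℝ}
    (hψs : ContDiff ℝ ∞ ψ) (hψ : tsupport ψ ⊆ Icc (-(1 / 2)) (1 / 2)) (hχs : ContDiff ℝ ∞ χ)
    (hχ : HasCompactSupport χ) (hT : 0 < T) (hR : 0 < R) :
    IsTestFunction T (prodTest ψ χ T R) where
  contDiff := by
    unfold prodTest
    exact (hψs.comp (contDiff_const.mul contDiff_fst)).mul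
      (hχs.comp (contDiff_snd.const_smul R⁻¹))
  hasCompactSupport := by
    refine IsCompact.of_isClosed_subset ?_ (isClosed_tsupport _)
      (tsupport_prodTest_subset hψ hχ hT hR)
    exact isCompact_Icc.prod (hχ.isCompact.image (continuous_const_smul R))
  tsupport_subset := by
    refine (tsupport_prodTest_subset hψ hχ hT hR).trans (prod_mono (fun t ht => ?_) (subset_univ _))
    exact lt_of_le_of_lt ht.2 (half_lt_self hT)

lemma timeDeriv_prodTest (ψ : ℝ → ℝ) (χ : EuclideanSpace ℝ (Fin n) → ℝ) (T R : ℝ) :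
    timeDeriv (prodTest ψ χ T R) = fun t x => T⁻¹ * prodTest (deriv ψ) χ T R t x := by
  funext t x
  simp only [timeDeriv, prodTest]
  rw [deriv_mul_const_field, deriv_comp_mul_left, smul_eq_mul, mul_assoc]

lemma timeDeriv_const_mul (c : ℝ) (Φ : ℝ → EuclideanSpace ℝ (Fin n) → ℝ) :
    timeDeriv (fun t x => c * Φ t x) = fun t x => c * timeDeriv Φ t x := by
  funext t x
  simp only [timeDeriv]
  rw [deriv_const_mul_field]

lemma fracLaplacian_prodTest (σ : ℝ) (ψ : ℝ → ℝ) (χ : EuclideanSpace ℝ (Fin n) → ℝ) (T : ℝ) {R : ℝ}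
    (hR : 0 < R) (t : ℝ) (x : EuclideanSpace ℝ (Fin n)) :
    fracLaplacian σ (prodTest ψ χ T R t) x =
      (R ^ (2 * σ))⁻¹ * (ψ (T⁻¹ * t) * fracLaplacian σ χ (R⁻¹ • x)) := by
  unfold prodTest
  rw [fracLaplacian_const_mul, fracLaplacian_comp_smul σ hR]
  ring

/-- The formally adjoint operator, applied to a product test function, gains a factor `T⁻¹` when
`R ^ {2σ} = T ≥ 1`: the terms of order `T⁻²` are the ones with two time derivatives and the one with
the visco-elastic damping. -/
lemma abs_adjoint_prodTest_le {ι : Type*} {q : ι → ℝ} {σ K M : ℝ} {ψ : ℝ → ℝ}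
    {φ : EuclideanSpace ℝ (Fin n) → ℝ} {φm : ℕ → EuclideanSpace ℝ (Fin n) → ℝ}
    (hφ : IsTestProfile σ φ φm K) (hψ : IsTimeCutoff q ψ M) {T R : ℝ} (hR : 0 < R)
    (hT : 1 ≤ T) (hRT : R ^ (2 * σ) = T) (hq : ∀ l, 1 < q l) (l : ι) (m : ℕ) (t : ℝ)
    (x : EuclideanSpace ℝ (Fin n)) :
    |timeDeriv (timeDeriv (prodTest ψ (φm m) T R)) t x +
        fracLaplacian σ (prodTest ψ (φm m) T R t) x - timeDeriv (prodTest ψ (φm m) T R) t x -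
        fracLaplacian σ (timeDeriv (prodTest ψ (φm m) T R) t) x| ≤
      (2 * M + K + M * K) * T⁻¹ * (ψ (T⁻¹ * t) ^ (1 / q l) * φ (R⁻¹ • x)) := by
  have hT0 : 0 < T := by linarith
  have hM : 0 ≤ M := hψ.const_nonneg l
  have hK : 0 ≤ K := hφ.const_pos.le
  have hTi : T⁻¹ * T⁻¹ ≤ T⁻¹ := mul_le_of_le_one_left (by positivity) (inv_le_one_of_one_le₀ hT)
  set s := T⁻¹ * t
  set y := R⁻¹ • x
  set P := ψ s ^ (1 / q l)
  have hP0 : 0 ≤ P := Real.rpow_nonneg (hψ.nonneg s) _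
  have hP : ψ s ≤ P := by
    have := Real.rpow_le_rpow_of_exponent_ge' (hψ.nonneg s) (hψ.le_one s) (z := 1 / q l)
      (by have := hq l; positivity) (by rw [div_le_one (by linarith [hq l])]; exact (hq l).le)
    rwa [Real.rpow_one] at this
  have hf0 := (hφ.pos y).le
  have e2 : fracLaplacian σ (fun x => T⁻¹ * prodTest (deriv ψ) (φm m) T R t x) x =
      T⁻¹ * (T⁻¹ * (deriv ψ s * fracLaplacian σ (φm m) y)) := by
    rw [fracLaplacian_const_mul, fracLaplacian_prodTest σ _ _ T hR, hRT]
  rw [timeDeriv_prodTest, timeDeriv_const_mul, timeDeriv_prodTest, fracLaplacian_prodTest σ _ _ T hR,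
    hRT, e2]
  simp only [prodTest]
  have h1 : |T⁻¹ * (T⁻¹ * (deriv (deriv ψ) s * φm m y))| ≤ T⁻¹ * (M * P * φ y) := by
    rw [← mul_assoc, abs_mul (T⁻¹ * T⁻¹), abs_of_nonneg (by positivity : 0 ≤ T⁻¹ * T⁻¹), abs_mul,
      abs_of_nonneg (hφ.nonneg m y)]
    have hm0 := hφ.nonneg m y
    gcongr
    · exact hψ.abs_deriv_deriv_le l s
    · exact hφ.le m y
  have h2 : |T⁻¹ * (ψ s * fracLaplacian σ (φm m) y)| ≤ T⁻¹ * (P * (K * φ y)) := by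
    rw [abs_mul, abs_mul, abs_of_nonneg (by positivity : 0 ≤ T⁻¹), abs_of_nonneg (hψ.nonneg s)]
    gcongr
    exact hφ.fracLaplacian_le m y
  have h3 : |T⁻¹ * (deriv ψ s * φm m y)| ≤ T⁻¹ * (M * P * φ y) := by
    rw [abs_mul, abs_mul, abs_of_nonneg (by positivity : 0 ≤ T⁻¹), abs_of_nonneg (hφ.nonneg m y)]
    gcongr
    · exact hφ.nonneg m y
    · exact hψ.abs_deriv_le l s
    · exact hφ.le m y
  have h4 : |T⁻¹ * (T⁻¹ * (deriv ψ s * fracLaplacian σ (φm m) y))| ≤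
      T⁻¹ * (M * P * (K * φ y)) := by
    rw [← mul_assoc, abs_mul (T⁻¹ * T⁻¹), abs_of_nonneg (by positivity : 0 ≤ T⁻¹ * T⁻¹), abs_mul]
    gcongr
    · exact hψ.abs_deriv_le l s
    · exact hφ.fracLaplacian_le m y
  have h5 := abs_le.1 h1
  have h6 := abs_le.1 h2
  have h7 := abs_le.1 h3
  have h8 := abs_le.1 h4
  rw [abs_le]
  constructor <;> linarith

end TestFun

/-! ### Estimates for one equation -/

section OneEquation

variable {n : ℕ}

/-- The slab `[0,T) × ℝⁿ`. -/
def slab (n : ℕ) (T : ℝ) : Set (ℝ × EuclideanSpace ℝ (Fin n)) := Ico 0 T ×ˢ univ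

lemma volume_restrict_slab (T : ℝ) :
    (volume.restrict (Ico 0 T)).prod (volume : Measure (EuclideanSpace ℝ (Fin n))) =
      volume.restrict (slab n T) := by
  rw [slab, Measure.volume_eq_prod, ← Measure.prod_restrict, Measure.restrict_univ]

lemma measurableSet_slab (T : ℝ) : MeasurableSet (slab n T) :=
  measurableSet_Ico.prod MeasurableSet.univ

/-- The integral of `|v|` over `[0,T) × ℝⁿ` against `ψ(t / T)^{1/q} φ(x / R)`. -/
noncomputable def weightedL1 (ψ : ℝ → ℝ) (φ : EuclideanSpace ℝ (Fin n) → ℝ) (T R q : ℝ)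
    (v : ℝ → EuclideanSpace ℝ (Fin n) → ℝ) : ℝ≥0∞ :=
  ∫⁻ z in slab n T, ‖v z.1 z.2‖ₑ * ENNReal.ofReal (ψ (T⁻¹ * z.1) ^ (1 / q) * φ (R⁻¹ • z.2))

lemma measurable_weight {ψ : ℝ → ℝ} {φ : EuclideanSpace ℝ (Fin n) → ℝ} (hψ : Continuous ψ)
    (hφ : Continuous φ) (T R r : ℝ) :
    Measurable fun z : ℝ × EuclideanSpace ℝ (Fin n) =>
      ENNReal.ofReal (ψ (T⁻¹ * z.1) ^ r * φ (R⁻¹ • z.2)) := by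
  have h1 : Measurable fun z : ℝ × EuclideanSpace ℝ (Fin n) => ψ (T⁻¹ * z.1) :=
    (hψ.comp (by fun_prop)).measurable
  have h2 : Measurable fun z : ℝ × EuclideanSpace ℝ (Fin n) => φ (R⁻¹ • z.2) :=
    (hφ.comp (by fun_prop)).measurable
  exact ((h1.pow_const r).mul h2).ennreal_ofReal

lemma enorm_iterated_integral_le {ψ : ℝ → ℝ} {φ : EuclideanSpace ℝ (Fin n) → ℝ} {T R q B : ℝ}
    (hψ : Continuous ψ) (hφ : Continuous φ) {v A : ℝ → EuclideanSpace ℝ (Fin n) → ℝ}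
    (hv : AEStronglyMeasurable (fun z : ℝ × EuclideanSpace ℝ (Fin n) => v z.1 z.2)
      (volume.restrict (slab n T))) (hB : 0 ≤ B)
    (hA : ∀ t x, |A t x| ≤ B * (ψ (T⁻¹ * t) ^ (1 / q) * φ (R⁻¹ • x))) :
    ‖∫ t in Ico 0 T, ∫ x, v t x * A t x‖ₑ ≤ ENNReal.ofReal B * weightedL1 ψ φ T R q v := by
  have hmeas : AEMeasurable (fun z : ℝ × EuclideanSpace ℝ (Fin n) => ‖v z.1 z.2‖ₑ *
      ENNReal.ofReal (ψ (T⁻¹ * z.1) ^ (1 / q) * φ (R⁻¹ • z.2))) (volume.restrict (slab n T)) :=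
    hv.enorm.mul (measurable_weight hψ hφ T R _).aemeasurable
  calc ‖∫ t in Ico 0 T, ∫ x, v t x * A t x‖ₑ
      ≤ ∫⁻ t in Ico 0 T, ∫⁻ x, ‖v t x * A t x‖ₑ :=
        (enorm_integral_le_lintegral_enorm _).trans
          (lintegral_mono fun t => enorm_integral_le_lintegral_enorm _)
    _ ≤ ∫⁻ t in Ico 0 T, ∫⁻ x, ENNReal.ofReal B * (‖v t x‖ₑ *
          ENNReal.ofReal (ψ (T⁻¹ * t) ^ (1 / q) * φ (R⁻¹ • x))) := by
        refine lintegral_mono fun t => lintegral_mono fun x => ?_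
        rw [enorm_mul, mul_left_comm, ← ENNReal.ofReal_mul hB]
        gcongr
        rw [Real.enorm_eq_ofReal_abs]
        exact ENNReal.ofReal_le_ofReal (hA t x)
    _ = _ := by
        rw [weightedL1, ← lintegral_const_mul'' _ hmeas, ← volume_restrict_slab, lintegral_prod]
        rw [volume_restrict_slab]
        exact hmeas.const_mul _

lemma integrableOn_mul_test {T : ℝ} {F Φ : ℝ → EuclideanSpace ℝ (Fin n) → ℝ}
    (hF : LocallyIntegrableOn (fun z : ℝ × EuclideanSpace ℝ (Fin n) => F z.1 z.2) (slab n T))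
    (hΦ : IsTestFunction T Φ) :
    IntegrableOn (fun z : ℝ × EuclideanSpace ℝ (Fin n) => F z.1 z.2 * Φ z.1 z.2) (slab n T) := by
  set K := tsupport (fun z : ℝ × EuclideanSpace ℝ (Fin n) => Φ z.1 z.2) ∩ (Ici 0 ×ˢ univ) with hK
  have hKc : IsCompact K :=
    IsCompact.inter_right hΦ.hasCompactSupport (isClosed_Ici.prod isClosed_univ)
  have hKs : K ⊆ slab n T := fun z hz => ⟨⟨hz.2.1, (hΦ.tsupport_subset hz.1).1⟩, mem_univ _⟩
  have h1 : IntegrableOn (fun z : ℝ × EuclideanSpace ℝ (Fin n) => F z.1 z.2 * Φ z.1 z.2) K :=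
    (hF.integrableOn_compact_subset hKs hKc).mul_continuousOn hΦ.contDiff.continuous.continuousOn hKc
  refine h1.of_forall_sdiff_eq_zero (measurableSet_slab T) fun z hz => ?_
  have : z ∉ tsupport (fun z : ℝ × EuclideanSpace ℝ (Fin n) => Φ z.1 z.2) :=
    fun h => hz.2 ⟨h, hz.1.1.1, mem_univ _⟩
  rw [image_eq_zero_of_notMem_tsupport this, mul_zero]

lemma ofReal_iterated_integral_mul_test {T : ℝ} {F Φ : ℝ → EuclideanSpace ℝ (Fin n) → ℝ}
    (hF : LocallyIntegrableOn (fun z : ℝ × EuclideanSpace ℝ (Fin n) => F z.1 z.2) (slab n T))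
    (hΦ : IsTestFunction T Φ) (hF0 : ∀ t x, 0 ≤ F t x) (hΦ0 : ∀ t x, 0 ≤ Φ t x) :
    ENNReal.ofReal (∫ t in Ico 0 T, ∫ x, F t x * Φ t x) =
      ∫⁻ z in slab n T, ENNReal.ofReal (F z.1 z.2 * Φ z.1 z.2) := by
  have h := integrableOn_mul_test hF hΦ
  have h' : Integrable (fun z : ℝ × EuclideanSpace ℝ (Fin n) => F z.1 z.2 * Φ z.1 z.2)
      ((volume.restrict (Ico 0 T)).prod volume) := by
    rw [volume_restrict_slab]; exact h
  rw [← integral_prod _ h', volume_restrict_slab]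
  exact ofReal_integral_eq_lintegral_ofReal h
    (Eventually.of_forall fun z => mul_nonneg (hF0 _ _) (hΦ0 _ _))

lemma tendsto_integral_mul_profile {σ K R : ℝ} {φ : EuclideanSpace ℝ (Fin n) → ℝ}
    {φm : ℕ → EuclideanSpace ℝ (Fin n) → ℝ} (hφ : IsTestProfile σ φ φm K)
    {f : EuclideanSpace ℝ (Fin n) → ℝ} (hf : Integrable f) :
    Tendsto (fun m => ∫ x, f x * φm m (R⁻¹ • x)) atTop (𝓝 (∫ x, f x * φ (R⁻¹ • x))) := by
  refine tendsto_integral_of_dominated_convergence (fun x => ‖f x‖ * K) (fun m => ?_)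
    (hf.norm.mul_const K) (fun m => Eventually.of_forall fun x => ?_)
    (Eventually.of_forall fun x => (hφ.tendsto _).const_mul _)
  · exact hf.aestronglyMeasurable.mul
      ((hφ.contDiff m).continuous.comp (continuous_const_smul _)).aestronglyMeasurable
  · rw [norm_mul, Real.norm_of_nonneg (hφ.nonneg m _)]
    gcongr
    exact (hφ.le m _).trans (hφ.bounded _)

/-- The weak formulation, tested with `ψ(t / T) φm(x / R)`. -/
lemma ofReal_source_add_data_le {ι : Type*} {q : ι → ℝ} {σ K M : ℝ} {ψ : ℝ → ℝ}
    {φ : EuclideanSpace ℝ (Fin n) → ℝ} {φm : ℕ → EuclideanSpace ℝ (Fin n) → ℝ}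
    (hφ : IsTestProfile σ φ φm K) (hψ : IsTimeCutoff q ψ M) {T R : ℝ} (hR : 0 < R)
    (hT : 1 ≤ T) (hRT : R ^ (2 * σ) = T) (hq : ∀ l, 1 < q l) (l : ι)
    {F v : ℝ → EuclideanSpace ℝ (Fin n) → ℝ} {v₀ v₁ f : EuclideanSpace ℝ (Fin n) → ℝ}
    (hv : AEStronglyMeasurable (fun z : ℝ × EuclideanSpace ℝ (Fin n) => v z.1 z.2)
      (volume.restrict (slab n T)))
    (hweak : IsWeakSolution σ T F v v₀ v₁)
    (hf : ∀ χ : EuclideanSpace ℝ (Fin n) → ℝ, ContDiff ℝ ∞ χ → HasCompactSupport χ →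
      ∫ x, v₀ x * (χ x + fracLaplacian σ χ x) = ∫ x, f x * χ x) (m : ℕ) :
    ENNReal.ofReal ((∫ t in Ico 0 T, ∫ x, F t x * prodTest ψ (φm m) T R t x) +
        ((∫ x, v₁ x * φm m (R⁻¹ • x)) + ∫ x, f x * φm m (R⁻¹ • x))) ≤
      ENNReal.ofReal ((2 * M + K + M * K) * T⁻¹) * weightedL1 ψ φ T R (q l) v := by
  have hT0 : 0 < T := by linarith
  have hM : 0 ≤ M := hψ.const_nonneg l
  have hK : 0 ≤ K := hφ.const_pos.le
  have htest := isTestFunction_prodTest hψ.contDiff hψ.tsupport_subset (hφ.contDiff m)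
    (hφ.hasCompactSupport m) hT0 hR
  have h0 : prodTest ψ (φm m) T R 0 = fun x => φm m (R⁻¹ • x) := by
    funext x
    simp [prodTest, hψ.zero]
  have hd0 : timeDeriv (prodTest ψ (φm m) T R) 0 = fun _ => 0 := by
    rw [timeDeriv_prodTest]
    funext x
    simp [prodTest, hψ.deriv_zero]
  have hcs : HasCompactSupport fun x => φm m (R⁻¹ • x) :=
    (hφ.hasCompactSupport m).comp_smul (inv_ne_zero hR.ne')
  have hsm : ContDiff ℝ ∞ fun x => φm m (R⁻¹ • x) :=
    (hφ.contDiff m).comp (contDiff_const_smul R⁻¹)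
  have hw := hweak _ htest
  rw [h0, hd0] at hw
  simp only [sub_zero] at hw
  rw [hf _ hsm hcs, add_assoc] at hw
  rw [hw]
  refine (ENNReal.ofReal_le_ofReal (le_abs_self _)).trans ?_
  rw [← Real.enorm_eq_ofReal_abs]
  exact enorm_iterated_integral_le hψ.contDiff.continuous hφ.continuous hv (by positivity)
    fun t x => abs_adjoint_prodTest_le hφ hψ hR hT hRT hq l m t x

/-- Passing to the limit along the approximation of the weight: the data and, when the data are
positive, the source are controlled by the solution. -/
lemma data_le_and_source_le {ι : Type*} {q : ι → ℝ} {σ K M : ℝ} {ψ : ℝ → ℝ}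
    {φ : EuclideanSpace ℝ (Fin n) → ℝ} {φm : ℕ → EuclideanSpace ℝ (Fin n) → ℝ}
    (hφ : IsTestProfile σ φ φm K) (hψ : IsTimeCutoff q ψ M) {T R : ℝ} (hR : 0 < R)
    (hT : 1 ≤ T) (hRT : R ^ (2 * σ) = T) (hq : ∀ l, 1 < q l) (l : ι)
    {F v : ℝ → EuclideanSpace ℝ (Fin n) → ℝ} {v₀ v₁ f : EuclideanSpace ℝ (Fin n) → ℝ}
    (hv : AEStronglyMeasurable (fun z : ℝ × EuclideanSpace ℝ (Fin n) => v z.1 z.2)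
      (volume.restrict (slab n T)))
    (hF : LocallyIntegrableOn (fun z : ℝ × EuclideanSpace ℝ (Fin n) => F z.1 z.2) (slab n T))
    (hF0 : ∀ t x, 0 ≤ F t x)
    (hweak : IsWeakSolution σ T F v v₀ v₁)
    (hf : ∀ χ : EuclideanSpace ℝ (Fin n) → ℝ, ContDiff ℝ ∞ χ → HasCompactSupport χ →
      ∫ x, v₀ x * (χ x + fracLaplacian σ χ x) = ∫ x, f x * χ x)
    (hfi : Integrable f) (hv₁ : Integrable v₁)
    (hpos : 0 < (∫ x, v₁ x * φ (R⁻¹ • x)) + ∫ x, f x * φ (R⁻¹ • x)) :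
    ENNReal.ofReal ((∫ x, v₁ x * φ (R⁻¹ • x)) + ∫ x, f x * φ (R⁻¹ • x)) ≤
        ENNReal.ofReal ((2 * M + K + M * K) * T⁻¹) * weightedL1 ψ φ T R (q l) v ∧
      ∫⁻ z in slab n T, ENNReal.ofReal (F z.1 z.2 * (ψ (T⁻¹ * z.1) * φ (R⁻¹ • z.2))) ≤
        ENNReal.ofReal ((2 * M + K + M * K) * T⁻¹) * weightedL1 ψ φ T R (q l) v := by
  have hT0 : 0 < T := by linarith
  have hmain := ofReal_source_add_data_le hφ hψ hR hT hRT hq l hv hweak hf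
  have hΦ0 : ∀ m t x, 0 ≤ prodTest ψ (φm m) T R t x := fun m t x =>
    mul_nonneg (hψ.nonneg _) (hφ.nonneg m _)
  have hI0 : ∀ m, 0 ≤ ∫ t in Ico 0 T, ∫ x, F t x * prodTest ψ (φm m) T R t x := fun m =>
    integral_nonneg fun t => integral_nonneg fun x => mul_nonneg (hF0 t x) (hΦ0 m t x)
  have hdata := (tendsto_integral_mul_profile (R := R) hφ hv₁).add
    (tendsto_integral_mul_profile (R := R) hφ hfi)
  constructor
  · refine le_of_tendsto (ENNReal.tendsto_ofReal hdata) (Eventually.of_forall fun m => ?_)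
    exact (ENNReal.ofReal_le_ofReal (le_add_of_nonneg_left (hI0 m))).trans (hmain m)
  · have hle : ∀ᶠ m in atTop, ∫⁻ z in slab n T,
        ENNReal.ofReal (F z.1 z.2 * prodTest ψ (φm m) T R z.1 z.2) ≤
        ENNReal.ofReal ((2 * M + K + M * K) * T⁻¹) * weightedL1 ψ φ T R (q l) v := by
      filter_upwards [hdata.eventually_const_lt hpos] with m hm
      rw [← ofReal_iterated_integral_mul_test hF (isTestFunction_prodTest hψ.contDiff
        hψ.tsupport_subset (hφ.contDiff m) (hφ.hasCompactSupport m) hT0 hR) hF0 (hΦ0 m)]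
      exact (ENNReal.ofReal_le_ofReal (le_add_of_nonneg_right hm.le)).trans (hmain m)
    have hlim : ∀ z : ℝ × EuclideanSpace ℝ (Fin n), Tendsto
        (fun m => ENNReal.ofReal (F z.1 z.2 * prodTest ψ (φm m) T R z.1 z.2)) atTop
        (𝓝 (ENNReal.ofReal (F z.1 z.2 * (ψ (T⁻¹ * z.1) * φ (R⁻¹ • z.2))))) := fun z =>
      ENNReal.tendsto_ofReal (((hφ.tendsto _).const_mul _).const_mul _)
    have hFm : AEMeasurable (fun z : ℝ × EuclideanSpace ℝ (Fin n) => F z.1 z.2)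
        (volume.restrict (slab n T)) :=
      hF.aestronglyMeasurable.aemeasurable
    calc _ = ∫⁻ z in slab n T, liminf (fun m =>
          ENNReal.ofReal (F z.1 z.2 * prodTest ψ (φm m) T R z.1 z.2)) atTop :=
          lintegral_congr fun z => (hlim z).liminf_eq.symm
      _ ≤ liminf (fun m => ∫⁻ z in slab n T,
          ENNReal.ofReal (F z.1 z.2 * prodTest ψ (φm m) T R z.1 z.2)) atTop := by
          refine lintegral_liminf_le' fun m => (hFm.mul ?_).ennreal_ofReal
          exact (isTestFunction_prodTest hψ.contDiff hψ.tsupport_subset (hφ.contDiff m)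
            (hφ.hasCompactSupport m) hT0 hR).contDiff.continuous.measurable.aemeasurable
      _ ≤ _ := liminf_le_of_frequently_le' hle.frequently

/-- Total mass of the rescaled weight over the slab. -/
lemma lintegral_slab_profile {φ : EuclideanSpace ℝ (Fin n) → ℝ} (hφ : Integrable φ)
    (hφc : Continuous φ) (hφ0 : ∀ x, 0 ≤ φ x) {T R : ℝ} (hT : 0 < T) (hR : 0 < R) :
    ∫⁻ z in slab n T, ENNReal.ofReal (φ (R⁻¹ • z.2)) =
      ENNReal.ofReal (T * (R ^ n * ∫ x, φ x)) := by
  have hm : Measurable fun z : ℝ × EuclideanSpace ℝ (Fin n) => ENNReal.ofReal (φ (R⁻¹ • z.2)) :=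
    (hφc.comp (by fun_prop)).measurable.ennreal_ofReal
  rw [← volume_restrict_slab, lintegral_prod _ hm.aemeasurable]
  dsimp only
  rw [lintegral_const,
    ← ofReal_integral_eq_lintegral_ofReal (hφ.comp_smul (inv_ne_zero hR.ne'))
      (Eventually.of_forall fun x => hφ0 _), Measure.integral_comp_inv_smul_of_nonneg _ _ hR.le,
    finrank_euclideanSpace_fin, Measure.restrict_apply_univ, Real.volume_Ico, sub_zero, mul_comm,
    ← ENNReal.ofReal_mul hT.le, smul_eq_mul]

/-- Hölder's inequality in the form used below. -/
lemma weightedL1_rpow_le {ψ : ℝ → ℝ} {φ : EuclideanSpace ℝ (Fin n) → ℝ} {T R q : ℝ}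
    (hψ : Continuous ψ) (hψ0 : ∀ t, 0 ≤ ψ t) (hφ : Continuous φ) (hφ0 : ∀ x, 0 < φ x) (hq : 1 < q)
    {v : ℝ → EuclideanSpace ℝ (Fin n) → ℝ}
    (hv : AEStronglyMeasurable (fun z : ℝ × EuclideanSpace ℝ (Fin n) => v z.1 z.2)
      (volume.restrict (slab n T))) :
    weightedL1 ψ φ T R q v ^ q ≤
      (∫⁻ z in slab n T, ENNReal.ofReal (|v z.1 z.2| ^ q * (ψ (T⁻¹ * z.1) * φ (R⁻¹ • z.2)))) *
        (∫⁻ z in slab n T, ENNReal.ofReal (φ (R⁻¹ • z.2))) ^ (q - 1) := by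
  have hq0 : 0 < q := by linarith
  have hpq : q.HolderConjugate (q / (q - 1)) := Real.HolderConjugate.conjExponent hq
  set f : ℝ × EuclideanSpace ℝ (Fin n) → ℝ≥0∞ := fun z =>
    ENNReal.ofReal (|v z.1 z.2| * (ψ (T⁻¹ * z.1) * φ (R⁻¹ • z.2)) ^ (1 / q)) with hf
  set g : ℝ × EuclideanSpace ℝ (Fin n) → ℝ≥0∞ := fun z =>
    ENNReal.ofReal (φ (R⁻¹ • z.2) ^ ((q - 1) / q)) with hg
  have hψm : Measurable fun z : ℝ × EuclideanSpace ℝ (Fin n) => ψ (T⁻¹ * z.1) :=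
    (hψ.comp (by fun_prop)).measurable
  have hφm : Measurable fun z : ℝ × EuclideanSpace ℝ (Fin n) => φ (R⁻¹ • z.2) :=
    (hφ.comp (by fun_prop)).measurable
  have hvm : AEMeasurable (fun z : ℝ × EuclideanSpace ℝ (Fin n) => |v z.1 z.2|)
      (volume.restrict (slab n T)) := hv.norm.aemeasurable
  have hfm : AEMeasurable f (volume.restrict (slab n T)) :=
    (hvm.mul ((hψm.mul hφm).pow_const _).aemeasurable).ennreal_ofReal
  have hgm : AEMeasurable g (volume.restrict (slab n T)) :=
    (hφm.pow_const _).ennreal_ofReal.aemeasurable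
  have hS : weightedL1 ψ φ T R q v = ∫⁻ z in slab n T, (f * g) z := by
    refine lintegral_congr fun z => ?_
    rw [Pi.mul_apply, hf, hg, Real.enorm_eq_ofReal_abs, ← ENNReal.ofReal_mul (abs_nonneg _),
      ← ENNReal.ofReal_mul (mul_nonneg (abs_nonneg _) (Real.rpow_nonneg
        (mul_nonneg (hψ0 _) (hφ0 _).le) _)), Real.mul_rpow (hψ0 _) (hφ0 _).le]
    congr 1
    have : φ (R⁻¹ • z.2) ^ (1 / q) * φ (R⁻¹ • z.2) ^ ((q - 1) / q) = φ (R⁻¹ • z.2) := by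
      rw [← Real.rpow_add (hφ0 _), ← add_div, add_sub_cancel, div_self hq0.ne', Real.rpow_one]
    linear_combination (-(|v z.1 z.2| * ψ (T⁻¹ * z.1) ^ (1 / q))) * this
  have hfq : ∀ z, f z ^ q =
      ENNReal.ofReal (|v z.1 z.2| ^ q * (ψ (T⁻¹ * z.1) * φ (R⁻¹ • z.2))) := fun z => by
    have h0 : 0 ≤ ψ (T⁻¹ * z.1) * φ (R⁻¹ • z.2) := mul_nonneg (hψ0 _) (hφ0 _).le
    rw [hf, ENNReal.ofReal_rpow_of_nonneg (mul_nonneg (abs_nonneg _) (Real.rpow_nonneg h0 _)) hq0.le,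
      Real.mul_rpow (abs_nonneg _) (Real.rpow_nonneg h0 _), ← Real.rpow_mul h0,
      one_div_mul_cancel hq0.ne', Real.rpow_one]
  have hgq : ∀ z, g z ^ (q / (q - 1)) = ENNReal.ofReal (φ (R⁻¹ • z.2)) := fun z => by
    have h1 : 0 < q - 1 := by linarith
    rw [hg, ENNReal.ofReal_rpow_of_nonneg (Real.rpow_nonneg (hφ0 _).le _) (by positivity),
      ← Real.rpow_mul (hφ0 _).le]
    congr 1
    rw [show (q - 1) / q * (q / (q - 1)) = 1 by field_simp, Real.rpow_one]
  have hH := ENNReal.lintegral_mul_le_Lp_mul_Lq _ hpq hfm hgm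
  rw [← hS, lintegral_congr hfq, lintegral_congr hgq] at hH
  refine (ENNReal.rpow_le_rpow hH hq0.le).trans (le_of_eq ?_)
  rw [ENNReal.mul_rpow_of_nonneg _ _ hq0.le, ← ENNReal.rpow_mul, ← ENNReal.rpow_mul,
    one_div_mul_cancel hq0.ne', ENNReal.rpow_one]
  congr 2
  field_simp

/-- A function in `C([0,T), L²)` is bounded in `L²` on every compact subset of `[0,T)`. -/
lemma IsContinuousL2.exists_bound {T : ℝ} {v : ℝ → EuclideanSpace ℝ (Fin n) → ℝ}
    (hv : IsContinuousL2 T v) {s : Set ℝ} (hs : IsCompact s) (hsT : s ⊆ Ico 0 T) :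
    ∃ C : ℝ≥0∞, C ≠ ⊤ ∧ ∀ t ∈ s, eLpNorm (v t) 2 ≤ C := by
  let P : Set ℝ → Prop := fun s => ∃ C : ℝ≥0∞, C ≠ ⊤ ∧ ∀ t ∈ s, eLpNorm (v t) 2 volume ≤ C
  have h0 : P ∅ := ⟨0, ENNReal.zero_ne_top, fun t ht => ht.elim⟩
  have hmono : ∀ ⦃s t : Set ℝ⦄, s ⊆ t → P t → P s := by
    rintro s t hst ⟨C, hC, h⟩
    exact ⟨C, hC, fun x hx => h x (hst hx)⟩
  have hunion : ∀ ⦃s t : Set ℝ⦄, P s → P t → P (s ∪ t) := by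
    rintro s t ⟨C, hC, h⟩ ⟨C', hC', h'⟩
    refine ⟨max C C', (max_lt hC.lt_top hC'.lt_top).ne, fun x hx => ?_⟩
    rcases hx with hx | hx
    · exact (h x hx).trans (le_max_left _ _)
    · exact (h' x hx).trans (le_max_right _ _)
  have hnhds : ∀ t ∈ s, ∃ u ∈ 𝓝[s] t, P u := by
    intro t ht
    have htT := hsT ht
    have h1 : ∀ᶠ r in 𝓝[Ico 0 T] t, eLpNorm (v r - v t) 2 volume < 1 :=
      (hv.continuous t htT).eventually_lt_const zero_lt_one
    refine ⟨{r | r ∈ Ico 0 T ∧ eLpNorm (v r - v t) 2 volume < 1}, ?_, 1 + eLpNorm (v t) 2 volume,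
      ENNReal.add_ne_top.2 ⟨ENNReal.one_ne_top, (hv.memLp t htT).eLpNorm_ne_top⟩, fun r hr => ?_⟩
    · refine nhdsWithin_mono t hsT ?_
      exact Filter.inter_mem self_mem_nhdsWithin h1
    · calc eLpNorm (v r) 2 volume = eLpNorm ((v r - v t) + v t) 2 volume := by rw [sub_add_cancel]
        _ ≤ eLpNorm (v r - v t) 2 volume + eLpNorm (v t) 2 volume :=
          eLpNorm_add_le ((hv.memLp r hr.1).1.sub (hv.memLp t htT).1) (hv.memLp t htT).1 (by norm_num)
        _ ≤ _ := by gcongr; exact hr.2.le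
  exact hs.induction_on h0 hmono hunion hnhds

lemma weightedL1_ne_top {ι : Type*} {p : ι → ℝ} {σ K M : ℝ} {ψ : ℝ → ℝ}
    {φ : EuclideanSpace ℝ (Fin n) → ℝ} {φm : ℕ → EuclideanSpace ℝ (Fin n) → ℝ}
    (hφ : IsTestProfile σ φ φm K) (hψ : IsTimeCutoff p ψ M) {T R q : ℝ} (hT : 0 < T) (hR : 0 < R)
    (hq : 0 < q) {v : ℝ → EuclideanSpace ℝ (Fin n) → ℝ} (hv : IsContinuousL2 T v) :
    weightedL1 ψ φ T R q v ≠ ⊤ := by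
  obtain ⟨C, hC, hCv⟩ := hv.exists_bound (s := Icc 0 (T / 2)) isCompact_Icc
    fun t ht => ⟨ht.1, ht.2.trans_lt (half_lt_self hT)⟩
  have hmeas : AEMeasurable (fun z : ℝ × EuclideanSpace ℝ (Fin n) => ‖v z.1 z.2‖ₑ *
      ENNReal.ofReal (ψ (T⁻¹ * z.1) ^ (1 / q) * φ (R⁻¹ • z.2))) (volume.restrict (slab n T)) :=
    hv.aestronglyMeasurable.enorm.mul
      (measurable_weight hψ.contDiff.continuous hφ.continuous T R _).aemeasurable
  have hφR : Integrable fun x => φ (R⁻¹ • x) := hφ.integrable.comp_smul (inv_ne_zero hR.ne')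
  set Z := ENNReal.ofReal K * C ^ 2 + ∫⁻ x, ENNReal.ofReal (φ (R⁻¹ • x)) with hZ
  have hZtop : Z ≠ ⊤ := by
    refine ENNReal.add_ne_top.2 ⟨ENNReal.mul_ne_top ENNReal.ofReal_ne_top (ENNReal.pow_ne_top hC),
      ?_⟩
    rw [← ofReal_integral_eq_lintegral_ofReal hφR (Eventually.of_forall fun x => (hφ.pos _).le)]
    exact ENNReal.ofReal_ne_top
  have hslice : ∀ t ∈ Ico 0 T, ∫⁻ x, ‖v t x‖ₑ *
      ENNReal.ofReal (ψ (T⁻¹ * t) ^ (1 / q) * φ (R⁻¹ • x)) ≤ Z := by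
    intro t ht
    rcases le_or_gt t (T / 2) with h | h
    · have hψ1 : ψ (T⁻¹ * t) ^ (1 / q) ≤ 1 :=
        Real.rpow_le_one (hψ.nonneg _) (hψ.le_one _) (by positivity)
      have hsq : ∫⁻ x, ‖v t x‖ₑ ^ 2 = eLpNorm (v t) 2 ^ 2 := by
        have := eLpNorm_nnreal_pow_eq_lintegral (f := v t) (μ := volume) (p := 2) (by norm_num)
        simpa using this.symm
      calc ∫⁻ x, ‖v t x‖ₑ * ENNReal.ofReal (ψ (T⁻¹ * t) ^ (1 / q) * φ (R⁻¹ • x))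
          ≤ ∫⁻ x, (ENNReal.ofReal K * ‖v t x‖ₑ ^ 2 + ENNReal.ofReal (φ (R⁻¹ • x))) := by
            refine lintegral_mono fun x => ?_
            have h1 : ENNReal.ofReal (ψ (T⁻¹ * t) ^ (1 / q) * φ (R⁻¹ • x)) ≤
                ENNReal.ofReal (φ (R⁻¹ • x)) :=
              ENNReal.ofReal_le_ofReal (mul_le_of_le_one_left (hφ.pos _).le hψ1)
            have h2 : ‖v t x‖ₑ ≤ ‖v t x‖ₑ ^ 2 + 1 := by
              rcases le_total ‖v t x‖ₑ 1 with h | h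
              · exact h.trans le_add_self
              · exact (le_self_pow₀ h two_ne_zero).trans le_self_add
            calc _ ≤ (‖v t x‖ₑ ^ 2 + 1) * ENNReal.ofReal (φ (R⁻¹ • x)) := by gcongr
              _ = ENNReal.ofReal (φ (R⁻¹ • x)) * ‖v t x‖ₑ ^ 2 + ENNReal.ofReal (φ (R⁻¹ • x)) := by
                  ring
              _ ≤ _ := by
                  gcongr
                  exact hφ.bounded _
        _ = ENNReal.ofReal K * (∫⁻ x, ‖v t x‖ₑ ^ 2) + ∫⁻ x, ENNReal.ofReal (φ (R⁻¹ • x)) := by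
            have hm : Measurable fun x => ENNReal.ofReal (φ (R⁻¹ • x)) :=
              (hφ.continuous.comp (continuous_const_smul _)).measurable.ennreal_ofReal
            rw [lintegral_add_right _ hm, lintegral_const_mul' _ _ ENNReal.ofReal_ne_top]
        _ ≤ Z := by
            rw [hsq, hZ]
            gcongr
            exact hCv t ⟨ht.1, h⟩
    · have h0 : ψ (T⁻¹ * t) = 0 := by
        refine image_eq_zero_of_notMem_tsupport fun hmem => ?_
        have := (hψ.tsupport_subset hmem).2
        rw [← div_eq_inv_mul, div_le_iff₀ hT] at this
        linarith
      simp [h0, Real.zero_rpow (inv_pos.2 hq).ne']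
  rw [weightedL1, ← volume_restrict_slab, lintegral_prod _ (by rwa [volume_restrict_slab])]
  refine ((setLIntegral_mono_ae' measurableSet_Ico
    (Eventually.of_forall hslice)).trans_lt ?_).ne
  rw [setLIntegral_const]
  exact ENNReal.mul_lt_top hZtop.lt_top measure_Ico_lt_top

end OneEquation

/-! ### The lifespan estimate -/

section Lifespan

variable {n k : ℕ}

/-- On large scales, the integral against the rescaled weight sees the mean of the data. -/
lemma tendsto_integral_mul_rescaled {σ K : ℝ} {φ : EuclideanSpace ℝ (Fin n) → ℝ}
    {φm : ℕ → EuclideanSpace ℝ (Fin n) → ℝ} (hφ : IsTestProfile σ φ φm K)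
    {f : EuclideanSpace ℝ (Fin n) → ℝ} (hf : Integrable f) :
    Tendsto (fun R : ℝ => ∫ x, f x * φ (R⁻¹ • x)) atTop (𝓝 ((∫ x, f x) * φ 0)) := by
  rw [← integral_mul_const]
  refine tendsto_integral_filter_of_dominated_convergence (fun x => ‖f x‖ * K)
    (Eventually.of_forall fun R => ?_) (Eventually.of_forall fun R => Eventually.of_forall fun x => ?_)
    (hf.norm.mul_const K) (Eventually.of_forall fun x => Tendsto.const_mul _ ?_)
  · exact hf.aestronglyMeasurable.mul
      (hφ.continuous.comp (continuous_const_smul _)).aestronglyMeasurable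
  · rw [norm_mul, Real.norm_of_nonneg (hφ.pos _).le]
    gcongr
    exact hφ.bounded _
  · have h : Tendsto (fun R : ℝ => R⁻¹ • x) atTop (𝓝 ((0 : ℝ) • x)) :=
      tendsto_inv_atTop_zero.smul_const x
    rw [zero_smul] at h
    exact (hφ.continuous.tendsto 0).comp h

/-- The quantities `S_j = ∬ |u_j| ψ^{1/q_j} φ` of a Sobolev solution satisfy the cyclic system of
inequalities, with the data as a lower bound. -/
lemma cyclic_estimate {σ : ℝ} (hσ : 1 ≤ σ) {p : Fin k → ℝ} (hp : ∀ l, 1 < p l)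
    {u₀ u₁ w : Fin k → EuclideanSpace ℝ (Fin n) → ℝ}
    (hw : ∀ l, IsOneAddFracLaplacian σ (u₀ l) (w l)) (hw_int : ∀ l, Integrable (w l))
    (hu₁_int : ∀ l, Integrable (u₁ l))
    {K M : ℝ} {ψ : ℝ → ℝ} {φ : EuclideanSpace ℝ (Fin n) → ℝ}
    {φm : ℕ → EuclideanSpace ℝ (Fin n) → ℝ} (hφ : IsTestProfile σ φ φm K)
    (hψ : IsTimeCutoff (fun l => p (finRotate k l)) ψ M) (hM : 0 ≤ M) {ε T R : ℝ} (hε : 0 < ε)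
    (hR : 0 < R) (hT : 1 ≤ T) (hRT : R ^ (2 * σ) = T)
    (hpos : ∀ l, 0 < (∫ x, u₁ l x * φ (R⁻¹ • x)) + ∫ x, w l x * φ (R⁻¹ • x))
    {u : Fin k → ℝ → EuclideanSpace ℝ (Fin n) → ℝ}
    (hu : IsSobolevSolution σ p T (fun l x => ε * u₀ l x) (fun l x => ε * u₁ l x) u) :
    ∃ S : Fin k → ℝ, (∀ j, 0 ≤ S j) ∧
      (∀ j, ε * ((∫ x, u₁ j x * φ (R⁻¹ • x)) + ∫ x, w j x * φ (R⁻¹ • x)) ≤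
        (2 * M + K + M * K) * T⁻¹ * S j) ∧
      ∀ j, S j ^ p (finRotate k j) ≤ (2 * M + K + M * K) * T⁻¹ * S (finRotate k j) *
        ((∫ x, φ x) * T ^ (1 + (n : ℝ) / (2 * σ))) ^ (p (finRotate k j) - 1) := by
  have hT0 : 0 < T := by linarith
  have hK := hφ.const_pos
  have hq : ∀ l, 1 < p (finRotate k l) := fun l => hp _
  set B := (2 * M + K + M * K) * T⁻¹ with hB_def
  have hB : 0 ≤ B := by positivity
  have hfin : ∀ j, weightedL1 ψ φ T R (p (finRotate k j)) (u j) ≠ ⊤ := fun j =>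
    weightedL1_ne_top hφ hψ hT0 hR (by linarith [hq j]) (hu.continuousL2 j)
  have hmain := fun l => data_le_and_source_le hφ hψ hR hT hRT hq l
    (hu.continuousL2 l).aestronglyMeasurable (hu.locallyIntegrableOn l)
    (fun t x => Real.rpow_nonneg (abs_nonneg _) _) (hu.weak l) (f := fun x => ε * w l x)
    (fun χ h1 h2 => by
      simp only [mul_assoc, integral_const_mul]
      rw [(hw l).pairing_eq χ h1 h2])
    ((hw_int l).const_mul ε) ((hu₁_int l).const_mul ε)
    (by
      simp only [mul_assoc, integral_const_mul]
      rw [← mul_add]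
      exact mul_pos hε (hpos l))
  set S : Fin k → ℝ := fun j => (weightedL1 ψ φ T R (p (finRotate k j)) (u j)).toReal with hS
  have hS0 : ∀ j, 0 ≤ S j := fun j => ENNReal.toReal_nonneg
  have hSe : ∀ j, weightedL1 ψ φ T R (p (finRotate k j)) (u j) = ENNReal.ofReal (S j) := fun j =>
    (ENNReal.ofReal_toReal (hfin j)).symm
  have hI : 0 ≤ ∫ x, φ x := integral_nonneg fun x => (hφ.pos x).le
  refine ⟨S, hS0, fun j => ?_, fun j => ?_⟩
  · have h := (hmain j).1
    rw [hSe j, ← ENNReal.ofReal_mul hB, ENNReal.ofReal_le_ofReal_iff (mul_nonneg hB (hS0 j))] at h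
    simp only [mul_assoc, integral_const_mul] at h
    rw [← mul_add] at h
    simpa only [mul_assoc] using h
  · have hq0 : 0 ≤ p (finRotate k j) := by linarith [hq j]
    have hq1 : 0 ≤ p (finRotate k j) - 1 := by linarith [hq j]
    have h := (hmain (finRotate k j)).2
    rw [Equiv.symm_apply_apply] at h
    have hmass : T * (R ^ n * ∫ x, φ x) = (∫ x, φ x) * T ^ (1 + (n : ℝ) / (2 * σ)) := by
      have hσ0 : 2 * σ ≠ 0 := by positivity
      have hRn : R ^ n = T ^ ((n : ℝ) / (2 * σ)) := by
        rw [← hRT, ← Real.rpow_mul hR.le, mul_div_cancel₀ _ hσ0, Real.rpow_natCast]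
      rw [Real.rpow_add hT0, Real.rpow_one, hRn]
      ring
    have hH := weightedL1_rpow_le (R := R) hψ.contDiff.continuous hψ.nonneg hφ.continuous hφ.pos
      (hq j) (hu.continuousL2 j).aestronglyMeasurable
    rw [lintegral_slab_profile hφ.integrable hφ.continuous (fun x => (hφ.pos x).le) hT0 hR,
      hmass] at hH
    have hfinal := hH.trans (mul_le_mul_left h _)
    rw [hSe j, hSe (finRotate k j), ← ENNReal.ofReal_mul hB,
      ENNReal.ofReal_rpow_of_nonneg (hS0 j) hq0,
      ENNReal.ofReal_rpow_of_nonneg (by positivity) hq1,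
      ← ENNReal.ofReal_mul (mul_nonneg hB (hS0 _)),
      ENNReal.ofReal_le_ofReal_iff (mul_nonneg (mul_nonneg hB (hS0 _)) (by positivity))] at hfinal
    exact hfinal

end Lifespan

end DoubleDamping

open DoubleDamping

theorem theorem1p3 (n k : ℕ) (hn : 1 ≤ n) (hk : 2 ≤ k) (σ : ℝ) (hσ : 1 ≤ σ)
    (p : Fin k → ℝ) (hp : ∀ l, 1 < p l)
    (u₀ u₁ w : Fin k → EuclideanSpace ℝ (Fin n) → ℝ)
    (hw : ∀ l, DoubleDamping.IsOneAddFracLaplacian σ (u₀ l) (w l))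
    (hw_int : ∀ l, MeasureTheory.Integrable (w l))
    (hu₁_int : ∀ l, MeasureTheory.Integrable (u₁ l))
    (hw_pos : ∀ l, 0 < ∫ x, w l x)
    (hu₁_pos : ∀ l, 0 < ∫ x, u₁ l x)
    (hγ : (n : ℝ) / (2 * σ) < DoubleDamping.gammaVec p ⟨k - 1, by omega⟩) :
    ∃ ε₀ : ℝ, 0 < ε₀ ∧ ∃ C : ℝ, 0 < C ∧ ∀ ε : ℝ, 0 < ε → ε ≤ ε₀ →
      DoubleDamping.lifeSpan σ p (fun l x => ε * u₀ l x) (fun l x => ε * u₁ l x) ≤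
        ENNReal.ofReal
          (C * ε ^ (-(1 / (DoubleDamping.gammaVec p ⟨k - 1, by omega⟩ - (n : ℝ) / (2 * σ))))) := by
  set i : Fin k := ⟨k - 1, by omega⟩ with hi
  obtain ⟨φ, φm, K, hφ⟩ := exists_isTestProfile n hσ
  obtain ⟨ψ, M, hψ⟩ := exists_isTimeCutoff (fun l => p (finRotate k l)) fun l => hp _
  have hM : 0 ≤ M := hψ.const_nonneg i
  have hK : 0 < K := hφ.const_pos
  have hI : 0 < ∫ x, φ x :=
    integral_pos_of_integrable_nonneg_nonzero hφ.continuous hφ.integrable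
      (fun x => (hφ.pos x).le) (x := 0) (hφ.pos 0).ne'
  -- On scales beyond `R₀` the data have positive integral against the rescaled weight.
  set m : Fin k → ℝ := fun l => (∫ x, u₁ l x) * φ 0 + (∫ x, w l x) * φ 0 with hm
  have hm0 : ∀ l, 0 < m l := fun l =>
    add_pos (mul_pos (hu₁_pos l) (hφ.pos 0)) (mul_pos (hw_pos l) (hφ.pos 0))
  have hev : ∀ᶠ R : ℝ in atTop, ∀ l,
      m l / 2 < (∫ x, u₁ l x * φ (R⁻¹ • x)) + ∫ x, w l x * φ (R⁻¹ • x) :=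
    eventually_all.2 fun l => ((tendsto_integral_mul_rescaled hφ (hu₁_int l)).add
      (tendsto_integral_mul_rescaled hφ (hw_int l))).eventually_const_lt (half_lt_self (hm0 l))
  obtain ⟨R₀, hR₀⟩ := eventually_atTop.1 (hev.and (eventually_ge_atTop 1))
  have hR₀1 : 1 ≤ R₀ := (hR₀ R₀ le_rfl).2
  set T₀ := R₀ ^ (2 * σ) with hT₀
  have hT₀1 : 1 ≤ T₀ := Real.one_le_rpow hR₀1 (by positivity)
  obtain ⟨C, hC, hCmain⟩ := exists_le_rpow_of_cyclic (fun l => p (finRotate k l)) (gammaVec p)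
    (fun l => hp _) (gammaVec_eq p hp) i (B := 2 * M + K + M * K) (δ := m i / 2) (I := ∫ x, φ x) hγ
    (by positivity) (half_pos (hm0 i)) hI
  refine ⟨1, one_pos, C + T₀, by positivity, fun ε hε hε1 => sSup_le ?_⟩
  rintro τ ⟨T, hT, rfl, u, hu⟩
  refine ENNReal.ofReal_le_ofReal ?_
  have ha : 0 < gammaVec p i - (n : ℝ) / (2 * σ) := sub_pos.2 hγ
  have hpow : 0 < ε ^ (-(1 / (gammaVec p i - (n : ℝ) / (2 * σ)))) := by positivity
  rcases le_total T T₀ with hTT | hTT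
  · have h1 : 1 ≤ ε ^ (-(1 / (gammaVec p i - (n : ℝ) / (2 * σ)))) :=
      Real.one_le_rpow_of_pos_of_le_one_of_nonpos hε hε1 (neg_nonpos.2 (by positivity))
    nlinarith
  · have hσ0 : 0 < 2 * σ := by positivity
    set R := T ^ (1 / (2 * σ)) with hR
    have hRR : R₀ ≤ R := by
      calc R₀ = T₀ ^ (1 / (2 * σ)) := by
            rw [hT₀, ← Real.rpow_mul (by linarith), mul_one_div_cancel hσ0.ne', Real.rpow_one]
        _ ≤ R := Real.rpow_le_rpow (by linarith) hTT (by positivity)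
    have hRT : R ^ (2 * σ) = T := by
      rw [hR, ← Real.rpow_mul hT.le, one_div_mul_cancel hσ0.ne', Real.rpow_one]
    have hdata := (hR₀ R hRR).1
    obtain ⟨S, hS0, hS1, hS2⟩ := cyclic_estimate hσ hp hw hw_int hu₁_int hφ hψ hM hε
      (by linarith : 0 < R) (hT₀1.trans hTT) hRT
      (fun l => (half_pos (hm0 l)).trans (hdata l)) hu
    have := hCmain ε T S hε hT hS0
      ((mul_le_mul_of_nonneg_left (hdata i).le hε.le).trans (hS1 i)) hS2
    nlinarith
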